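/- Let $\mathbb K$ be a field of characteristic zero and $A$ an associative $\mathbb K$-algebra. Let $T(A)=\bigoplus_{n>0}A^{\otimes n}$ (words $a_1\cdots a_n$), let $NC_n$ be the set of non-crossing partitions of $[n]=\{1,\dots,n\}$, and let $\mathcal{NC}(A)=\bigoplus_{n>0}\mathbb K[NC_n]\otimes A^{\otimes n}$ be the space of decorated non-crossing partitions (its degree-zero part $\mathbb K$ being identified with the scalars of the tensor algebra below). For $V=T(A)$ or $V=\mathcal{NC}(A)$ let $\overline T(V)$ be the unital tensor algebra, with product written $a|b$, $T(V)$ the span of the words of positive length in elements of $V$, and $e:\overline T(V)\to\mathbb K$ the augmentation ($e(\mathbf 1)=1$, $e=0$ on $T(V)$). *Coproducts.* For $S\subseteq[n]$ let $J_1,\dots,J_k$ be the connected components (maximal sets of successive elements) of $[n]\setminus S$, from left to right. For $S=\{s_1<\dots<s_p\}$ put $a_S=a_{s_1}\cdots a_{s_p}$, and let $L|_S$ be the restriction of $L\in NC_n$ to $S$, standardized to a non-crossing partition of $[p]$; for $S=\emptyset$, $a_S$ and $L|_S\otimes a_S$ mean $\mathbf 1$. Define $$\Delta(a_1\cdots a_n)=\sum_{S\subseteq[n]}a_S\otimes(a_{J_1}|\cdots|a_{J_k}),$$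 $$\Delta(L\otimes a_1\cdots a_n)=\sum_{S}(L|_S\otimes a_S)\otimes\big(L|_{J_1}\otimes a_{J_1}\,|\cdots|\,L|_{J_k}\otimes a_{J_k}\big),$$ where in the second formula $S$ runs over the unions of blocks of $L$ that are admissible: there are no block $Q\subseteq S$ and block $U\subseteq[n]\setminus S$ of $L$ with $\inf U<m<\sup U$ for all $m\in Q$. Let $\Delta^+_\prec$ be given by the same sums restricted to those $S$ that contain $1$. Extend to words in elements of $V$ by $\Delta(w_1|\cdots|w_m)=\Delta(w_1)\cdots\Delta(w_m)$, $\Delta(\mathbf 1)=\mathbf 1\otimes\mathbf 1$, and $\Delta^+_\prec(w_1|\cdots|w_m)=\Delta^+_\prec(w_1)\Delta(w_2)\cdots\Delta(w_m)$ for $m\ge1$, and put $\Delta_\prec(w)=\Delta^+_\prec(w)-w\otimes\mathbf 1$ for $w\in T(V)$. *Half-shuffle and exponential.* For linear forms $f,g$ on $\overline T(V)$ vanishing on $\mathbf 1$, let $f\prec g=m_{\mathbb K}\circ(f\otimes g)\circ\Delta_\prec$ on $T(V)$, and $(f\prec g)(\mathbf 1)=0$; further $f\prec e=f$ and $e\prec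 f=0$, extended bilinearly. Put $\kappa^{\prec0}=e$, $\kappa^{\prec n}=\kappa\prec\kappa^{\prec(n-1)}$ and $\exp^\prec(\kappa)=\sum_{n\ge0}\kappa^{\prec n}$, the sum being taken pointwise. *Characters.* A linear form $\Phi$ on $\overline T(V)$ is a character if $\Phi(\mathbf 1)=1$ and $\Phi(a|b)=\Phi(a)\Phi(b)$ for all $a,b\in T(V)$; a linear form $\kappa$ is an infinitesimal character if $\kappa(\mathbf 1)=0$ and $\kappa(a|b)=0$ for all $a,b\in T(V)$. Write $G_{NC}(A)$, $g_{NC}(A)$ for the sets of characters and infinitesimal characters on $\overline T(\mathcal{NC}(A))$, and $G(A)$, $g(A)$ for those on $\overline T(T(A))$. *Splitting.* Let $Sp:\overline T(T(A))\to\overline T(\mathcal{NC}(A))$ be the unital algebra morphism with $Sp(a_1\cdots a_n)=\sum_{L\in NC_n}L\otimes a_1\cdots a_n$, and $Sp^*(f)=f\circ Sp$. **Theorem.** 1. For $\kappa\in g_{NC}(A)$ the series $\exp^\prec(\kappa)$ is pointwise a finite sum, and $\kappa\mapsto\exp^\prec(\kappa)$ is a bijection from $g_{NC}(A)$ onto $G_{NC}(A)$;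 in particular $\exp^\prec(\kappa)$ is a character for every $\kappa\in g_{NC}(A)$. 2. For each $\Phi\in G_{NC}(A)$ there is a unique $\kappa\in g_{NC}(A)$ with $$\Phi=e+\kappa\prec\Phi=\exp^\prec(\kappa);$$ moreover each of the two equations $\Phi=e+\kappa\prec\Phi$ and $\Phi=\exp^\prec(\kappa)$ alone determines this $\kappa$ in $g_{NC}(A)$. 3. The correspondence commutes with $Sp^*$: for $\Phi\in G_{NC}(A)$ and $\kappa\in g_{NC}(A)$ as in 2, one has $Sp^*(\Phi)\in G(A)$, $Sp^*(\kappa)\in g(A)$, the series $\exp^\prec(Sp^*(\kappa))$ is pointwise a finite sum, and $$Sp^*(\Phi)=e+Sp^*(\kappa)\prec Sp^*(\Phi)=\exp^\prec(Sp^*(\kappa)).$$ -/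

import Mathlib

open scoped TensorProduct DirectSum

noncomputable section

namespace SplittingProcess

/-! ## Linear forms on a tensor algebra carrying a left half-coproduct

For a `K`-vector space `V`, the unital tensor algebra over `V` is `TensorAlgebra K V`; its product
is concatenation, written `w₁ | ⋯ | wₘ` in the bar notation.  The non-unital tensor algebra over `V`
is the kernel of the augmentation `counit`. -/

section Generic

variable {K : Type*} [Field K] {V : Type*} [AddCommMonoid V] [Module K V]

/-- The augmentation `e`: the identity on scalars, zero on words of positive length. -/
def counit (K : Type*) [Field K] (V : Type*) [AddCommMonoid V] [Module K V] :
    Module.Dual K (TensorAlgebra K V) :=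
  (TensorAlgebra.algebraMapInv (R := K) (M := V)).toLinearMap

/-- Characters: unital linear forms, multiplicative on the non-unital tensor algebra. -/
def characters (K : Type*) [Field K] (V : Type*) [AddCommMonoid V] [Module K V] :
    Set (Module.Dual K (TensorAlgebra K V)) :=
  {Φ | Φ 1 = 1 ∧ ∀ a b, counit K V a = 0 → counit K V b = 0 → Φ (a * b) = Φ a * Φ b}

/-- Infinitesimal characters: linear forms that vanish on `1` and on all products of two elements
of the non-unital tensor algebra. -/
def infinitesimalCharacters (K : Type*) [Field K] (V : Type*) [AddCommMonoid V] [Module K V] :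
    Set (Module.Dual K (TensorAlgebra K V)) :=
  {κ | κ 1 = 0 ∧ ∀ a b, counit K V a = 0 → counit K V b = 0 → κ (a * b) = 0}

/-- The multiplicative extension `Δ(w₁ | ⋯ | wₘ) = Δ(w₁) ⋯ Δ(wₘ)`, `Δ(1) = 1 ⊗ 1`, of a map
`δ` on the generators. -/
def coproduct (δ : V →ₗ[K] TensorAlgebra K V ⊗[K] TensorAlgebra K V) :
    TensorAlgebra K V →ₐ[K] TensorAlgebra K V ⊗[K] TensorAlgebra K V :=
  TensorAlgebra.lift K δ

/-- Auxiliary operator `(p, q) ↦ (δ(v) p, δ⁺(v) p)`. -/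
def leftStep (δplus δ : V →ₗ[K] TensorAlgebra K V ⊗[K] TensorAlgebra K V) :
    V →ₗ[K] Module.End K ((TensorAlgebra K V ⊗[K] TensorAlgebra K V) ×
      (TensorAlgebra K V ⊗[K] TensorAlgebra K V)) where
  toFun v := ((LinearMap.mulLeft K (δ v)).prod (LinearMap.mulLeft K (δplus v))) ∘ₗ
    LinearMap.fst K _ _
  map_add' v w := by
    ext x <;> simp [add_mul]
  map_smul' c v := by
    ext x <;> simp

/-- The extension `Δ⁺(w₁ | ⋯ | wₘ) = Δ⁺(w₁) Δ(w₂) ⋯ Δ(wₘ)` to words of positive length of the map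
`δplus = Δ⁺` on the generators, with value `0` on `1`; it is characterized by `leftHalfPlus_one` and
`leftHalfPlus_ι_mul` below. -/
def leftHalfPlus (δplus δ : V →ₗ[K] TensorAlgebra K V ⊗[K] TensorAlgebra K V) :
    TensorAlgebra K V →ₗ[K] TensorAlgebra K V ⊗[K] TensorAlgebra K V :=
  LinearMap.snd K _ _ ∘ₗ LinearMap.applyₗ (1, 0) ∘ₗ
    (TensorAlgebra.lift K (leftStep δplus δ)).toLinearMap

theorem leftHalfPlus_one (δplus δ : V →ₗ[K] TensorAlgebra K V ⊗[K] TensorAlgebra K V) :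
    leftHalfPlus δplus δ 1 = 0 := by
  simp [leftHalfPlus]

theorem lift_leftStep_fst (δplus δ : V →ₗ[K] TensorAlgebra K V ⊗[K] TensorAlgebra K V)
    (x : TensorAlgebra K V) (p q : TensorAlgebra K V ⊗[K] TensorAlgebra K V) :
    (TensorAlgebra.lift K (leftStep δplus δ) x (p, q)).1 = coproduct δ x * p := by
  induction x using TensorAlgebra.induction generalizing p q with
  | algebraMap r => simp [Algebra.algebraMap_eq_smul_one]
  | ι v => simp [leftStep, coproduct]
  | mul a b ha hb =>
    rw [map_mul, map_mul, Module.End.mul_apply,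
      ← Prod.mk.eta (p := (TensorAlgebra.lift K (leftStep δplus δ)) b (p, q)), ha, hb, mul_assoc]
  | add a b ha hb => simp [ha, hb, add_mul]

theorem leftHalfPlus_ι_mul (δplus δ : V →ₗ[K] TensorAlgebra K V ⊗[K] TensorAlgebra K V)
    (v : V) (x : TensorAlgebra K V) :
    leftHalfPlus δplus δ (TensorAlgebra.ι K v * x) = δplus v * coproduct δ x := by
  have h := lift_leftStep_fst δplus δ x 1 0
  rw [mul_one] at h
  simp only [leftHalfPlus, LinearMap.comp_apply, AlgHom.toLinearMap_apply, map_mul,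
    TensorAlgebra.lift_ι_apply, LinearMap.applyₗ_apply_apply, Module.End.mul_apply]
  rw [← h]
  rfl

/-- The left half-coproduct: `Δ_≺(w) = Δ⁺(w) - w ⊗ 1` for `w` in the non-unital tensor
algebra, extended by `0` to scalars. -/
def leftHalf (δplus δ : V →ₗ[K] TensorAlgebra K V ⊗[K] TensorAlgebra K V) :
    TensorAlgebra K V →ₗ[K] TensorAlgebra K V ⊗[K] TensorAlgebra K V :=
  leftHalfPlus δplus δ -
    (TensorProduct.mk K (TensorAlgebra K V) (TensorAlgebra K V)).flip 1 ∘ₗ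
      (LinearMap.id - Algebra.linearMap K (TensorAlgebra K V) ∘ₗ counit K V)

/-- The part `f° = f - f(1) e` of a linear form, which vanishes on scalars. -/
def reducedForm (f : Module.Dual K (TensorAlgebra K V)) : Module.Dual K (TensorAlgebra K V) :=
  f - f 1 • counit K V

/-- The left half-shuffle product attached to a left half-coproduct `D = Δ_≺`.  For linear forms
`f`, `g` on the non-unital tensor algebra it is `f ≺ g = m ∘ (f ⊗ g) ∘ Δ_≺`; it is extended
bilinearly to forms on the unital one by `f ≺ e = f` and `e ≺ f = 0` (and `e ≺ e = 0`). -/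
def prec (D : TensorAlgebra K V →ₗ[K] TensorAlgebra K V ⊗[K] TensorAlgebra K V)
    (f g : Module.Dual K (TensorAlgebra K V)) : Module.Dual K (TensorAlgebra K V) :=
  LinearMap.mul' K K ∘ₗ TensorProduct.map (reducedForm f) (reducedForm g) ∘ₗ D
    + g 1 • reducedForm f

/-- `κ^{≺ 0} = e` and `κ^{≺ (n+1)} = κ ≺ κ^{≺ n}`. -/
def precPow (D : TensorAlgebra K V →ₗ[K] TensorAlgebra K V ⊗[K] TensorAlgebra K V)
    (κ : Module.Dual K (TensorAlgebra K V)) : ℕ → Module.Dual K (TensorAlgebra K V)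
  | 0 => counit K V
  | n + 1 => prec D κ (precPow D κ n)

/-- The series `∑ₙ κ^{≺ n}` is pointwise finite. -/
def PrecExpConverges (D : TensorAlgebra K V →ₗ[K] TensorAlgebra K V ⊗[K] TensorAlgebra K V)
    (κ : Module.Dual K (TensorAlgebra K V)) : Prop :=
  ∀ x, (Function.support fun n : ℕ => precPow D κ n x).Finite

open Classical in
/-- `exp^≺(κ) = ∑ₙ κ^{≺ n}`, computed pointwise; the value is `0` if the series is not pointwise
finite. -/
def precExp (D : TensorAlgebra K V →ₗ[K] TensorAlgebra K V ⊗[K] TensorAlgebra K V)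
    (κ : Module.Dual K (TensorAlgebra K V)) : Module.Dual K (TensorAlgebra K V) :=
  if h : PrecExpConverges D κ then
    { toFun := fun x => ∑ᶠ n : ℕ, precPow D κ n x
      map_add' := fun x y => by
        simp only [map_add]
        exact finsum_add_distrib (h x) (h y)
      map_smul' := fun c x => by
        simp only [map_smul, RingHom.id_apply]
        exact (smul_finsum' c (h x)).symm }
  else 0

end Generic

/-! ## Subsets of `[n]` and their complementary components

The set `[n]` is `Fin n`, so that the element `1` of `[n]` is the index with value `0`. -/

/-- The list, from left to right, of the connected components of `[n] - S`, that is, of the maximal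
sets of successive elements of `[n]` that do not meet `S`; each is recovered from its least
element `i`. -/
def components {n : ℕ} (S : Finset (Fin n)) : List (Finset (Fin n)) :=
  ((Finset.univ.filter fun i => i ∉ S ∧ ∀ j < i, ∃ k ∈ S, j ≤ k ∧ k < i).sort (· ≤ ·)).map
    fun i => Finset.univ.filter fun j => i ≤ j ∧ ∀ k, i ≤ k → k ≤ j → k ∉ S

theorem pairwise_disjoint_components {n : ℕ} (S : Finset (Fin n)) :
    (components S).Pairwise Disjoint := by
  unfold components
  rw [List.pairwise_map]
  have h := Finset.sortedLT_sort
    (Finset.univ.filter fun i => i ∉ S ∧ ∀ j < i, ∃ k ∈ S, j ≤ k ∧ k < i)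
  refine h.pairwise.imp_of_mem ?_
  intro i i' hi hi' hlt
  simp only [Finset.mem_sort, Finset.mem_filter, Finset.mem_univ, true_and] at hi hi'
  rw [Finset.disjoint_left]
  intro j hj hj'
  simp only [Finset.mem_filter, Finset.mem_univ, true_and] at hj hj'
  obtain ⟨k, hk, h1, h2⟩ := hi'.2 i hlt
  exact hj.2 k h1 (h2.le.trans hj'.1) hk

theorem exists_mem_components_iff {n : ℕ} (S : Finset (Fin n)) (j : Fin n) :
    (∃ J ∈ components S, j ∈ J) ↔ j ∉ S := by
  constructor
  · rintro ⟨J, hJ, hj⟩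
    simp only [components, List.mem_map] at hJ
    obtain ⟨i, -, rfl⟩ := hJ
    simp only [Finset.mem_filter, Finset.mem_univ, true_and] at hj
    exact hj.2 j hj.1 le_rfl
  · intro hj
    let P : Finset (Fin n) :=
      Finset.univ.filter fun i => i ≤ j ∧ ∀ k, i ≤ k → k ≤ j → k ∉ S
    have hP : P.Nonempty := ⟨j, by
      simp only [P, Finset.mem_filter, Finset.mem_univ, true_and]
      exact ⟨le_rfl, fun k h1 h2 => le_antisymm h1 h2 ▸ hj⟩⟩
    have hm := P.min'_mem hP
    set i := P.min' hP with hi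
    simp only [P, Finset.mem_filter, Finset.mem_univ, true_and] at hm
    refine ⟨_, List.mem_map.2 ⟨i, ?_, rfl⟩, ?_⟩
    · simp only [Finset.mem_sort, Finset.mem_filter, Finset.mem_univ, true_and]
      refine ⟨hm.2 i le_rfl hm.1, fun l hl => ?_⟩
      by_contra hcon
      push Not at hcon
      have : l ∈ P := by
        simp only [P, Finset.mem_filter, Finset.mem_univ, true_and]
        refine ⟨hl.le.trans hm.1, fun k h1 h2 hk => ?_⟩
        exact hm.2 k (hcon k hk h1) h2 hk
      exact absurd (P.min'_le l this) (not_le.2 hl)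
    · simpa using hm

/-! ## Maps that are multilinear in a set of letters -/

/-- `f (a₁, …, aₙ)` is linear in each letter indexed by `S` and independent of all others. -/
def MultilinearOn (K : Type*) [Field K] {A B : Type*} [AddCommMonoid A] [Module K A]
    [AddCommMonoid B] [Module K B] {n : ℕ} (S : Finset (Fin n)) (f : (Fin n → A) → B) : Prop :=
  (∀ i ∈ S, ∀ a x y, f (Function.update a i (x + y)) =
      f (Function.update a i x) + f (Function.update a i y)) ∧
  (∀ i ∈ S, ∀ a (c : K) x, f (Function.update a i (c • x)) = c • f (Function.update a i x)) ∧
  (∀ i ∉ S, ∀ a x, f (Function.update a i x) = f a)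

section Multilinear

variable {K : Type*} [Field K] {A : Type*} [AddCommMonoid A] [Module K A]

theorem MultilinearOn.bilin {B C E : Type*} [AddCommMonoid B] [Module K B] [AddCommMonoid C]
    [Module K C] [AddCommMonoid E] [Module K E] {n : ℕ} {S T : Finset (Fin n)} (hST : Disjoint S T)
    {f : (Fin n → A) → B} {g : (Fin n → A) → C} (hf : MultilinearOn K S f)
    (hg : MultilinearOn K T g) (m : B →ₗ[K] C →ₗ[K] E) :
    MultilinearOn K (S ∪ T) fun a => m (f a) (g a) := by
  obtain ⟨hf1, hf2, hf3⟩ := hf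
  obtain ⟨hg1, hg2, hg3⟩ := hg
  refine ⟨fun i hi a x y => ?_, fun i hi a c x => ?_, fun i hi a x => ?_⟩
  · rcases Finset.mem_union.1 hi with h | h
    · have h' := Finset.disjoint_left.1 hST h
      simp [hf1 i h, hg3 i h']
    · have h' := Finset.disjoint_right.1 hST h
      simp [hg1 i h, hf3 i h']
  · rcases Finset.mem_union.1 hi with h | h
    · have h' := Finset.disjoint_left.1 hST h
      simp [hf2 i h, hg3 i h']
    · have h' := Finset.disjoint_right.1 hST h
      simp [hg2 i h, hf3 i h']
  · rw [Finset.mem_union, not_or] at hi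
    simp [hf3 i hi.1, hg3 i hi.2]

theorem MultilinearOn.list_prod {B : Type*} [Semiring B] [Algebra K B] {n : ℕ}
    {w : Finset (Fin n) → (Fin n → A) → B} (hw : ∀ J, MultilinearOn K J (w J))
    (l : List (Finset (Fin n))) (hl : l.Pairwise Disjoint) :
    MultilinearOn K (Finset.univ.filter fun j => ∃ J ∈ l, j ∈ J)
      fun a => (l.map fun J => w J a).prod := by
  induction l with
  | nil => exact ⟨by simp, by simp, by simp⟩
  | cons J l ih =>
    rw [List.pairwise_cons] at hl
    have hd : Disjoint J (Finset.univ.filter fun j => ∃ J ∈ l, j ∈ J) := by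
      rw [Finset.disjoint_left]
      rintro j hj hj'
      simp only [Finset.mem_filter, Finset.mem_univ, true_and] at hj'
      obtain ⟨J', hJ', hj'⟩ := hj'
      exact Finset.disjoint_left.1 (hl.1 J' hJ') hj hj'
    have h := MultilinearOn.bilin hd (hw J) (ih hl.2) (LinearMap.mul K B)
    have hS : (Finset.univ.filter fun j => ∃ J' ∈ J :: l, j ∈ J') =
        J ∪ (Finset.univ.filter fun j => ∃ J ∈ l, j ∈ J) := by
      ext j; simp
    rw [hS]
    simpa using h

/-- For a family `w J a` of elements of an algebra, multilinear in the letters indexed by `J`, the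
multilinear map `a ↦ w S a ⊗ (w J₁ a | ⋯ | w Jₖ a)`, where `J₁, …, Jₖ` are the connected components
of `[n] - S`. -/
def coproductTerm {B : Type*} [Semiring B] [Algebra K B] {n : ℕ}
    (w : Finset (Fin n) → (Fin n → A) → B) (hw : ∀ J, MultilinearOn K J (w J))
    (S : Finset (Fin n)) : MultilinearMap K (fun _ : Fin n => A) (B ⊗[K] B) :=
  have h : MultilinearOn K Finset.univ
      (fun a => w S a ⊗ₜ[K] ((components S).map fun J => w J a).prod) := by
    have hd : Disjoint S (Finset.univ.filter fun j => ∃ J ∈ components S, j ∈ J) := by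
      rw [Finset.disjoint_left]
      intro j hj hj'
      simp only [Finset.mem_filter, Finset.mem_univ, true_and, exists_mem_components_iff] at hj'
      exact hj' hj
    have h := MultilinearOn.bilin hd (hw S)
      (MultilinearOn.list_prod hw (components S) (pairwise_disjoint_components S))
      (TensorProduct.mk K B B)
    have hS : S ∪ (Finset.univ.filter fun j => ∃ J ∈ components S, j ∈ J) = Finset.univ := by
      ext j
      simp only [Finset.mem_union, Finset.mem_filter, Finset.mem_univ, true_and,
        exists_mem_components_iff, iff_true]
      exact em _
    rw [hS] at h
    exact h
  MultilinearMap.mk' (fun a => w S a ⊗ₜ[K] ((components S).map fun J => w J a).prod)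
    (fun a i x y => h.1 i (Finset.mem_univ i) a x y)
    (fun a i c x => h.2.1 i (Finset.mem_univ i) a c x)

theorem coproductTerm_apply {B : Type*} [Semiring B] [Algebra K B] {n : ℕ}
    (w : Finset (Fin n) → (Fin n → A) → B) (hw : ∀ J, MultilinearOn K J (w J))
    (S : Finset (Fin n)) (a : Fin n → A) :
    coproductTerm w hw S a = w S a ⊗ₜ[K] ((components S).map fun J => w J a).prod := rfl

/-- The word `a_S = a_{s₁} ⋯ a_{sₖ}` for `S = {s₁ < ⋯ < sₖ}`. -/
def subword (K : Type*) [Field K] {A : Type*} [AddCommMonoid A] [Module K A] {n : ℕ}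
    (S : Finset (Fin n)) (a : Fin n → A) : ⨂[K]^S.card A :=
  PiTensorProduct.tprod K fun i => a (S.orderEmbOfFin rfl i)

theorem multilinearOn_subword {n : ℕ} (S : Finset (Fin n)) :
    MultilinearOn K S (subword K (A := A) S) := by
  have key : ∀ (p : Fin S.card) (a : Fin n → A) (x : A),
      (fun q => Function.update a (S.orderEmbOfFin rfl p) x (S.orderEmbOfFin rfl q)) =
        Function.update (fun q => a (S.orderEmbOfFin rfl q)) p x := fun p a x =>
    Function.update_comp_eq_of_injective a (S.orderEmbOfFin rfl).injective p x
  have hmem : ∀ i ∈ S, ∃ p, S.orderEmbOfFin rfl p = i := fun i hi => by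
    have : i ∈ Set.range (S.orderEmbOfFin rfl) := by simpa using hi
    exact this
  refine ⟨fun i hi a x y => ?_, fun i hi a c x => ?_, fun i hi a x => ?_⟩
  · obtain ⟨p, rfl⟩ := hmem i hi
    simp only [subword, key]
    exact MultilinearMap.map_update_add _ _ _ _ _
  · obtain ⟨p, rfl⟩ := hmem i hi
    simp only [subword, key]
    exact MultilinearMap.map_update_smul _ _ _ _ _
  · simp only [subword]
    congr 1
    funext q
    refine Function.update_of_ne ?_ _ _
    rintro rfl
    exact hi (S.orderEmbOfFin_mem rfl q)

end Multilinear

/-! ## The double tensor algebra -/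

/-- The non-unital tensor algebra `T(A)`, as a vector space: the sum of the `A^{⊗ n}`, `n > 0`. -/
abbrev Words (K : Type*) [Field K] (A : Type*) [AddCommMonoid A] [Module K A] : Type _ :=
  ⨁ n : ℕ+, ⨂[K]^(n : ℕ) A

section DoubleTensor

variable (K : Type*) [Field K] (A : Type*) [AddCommMonoid A] [Module K A]

/-- The word `a_S`, as a generator of the double tensor algebra; `a_∅ = 1`. -/
def wordAt {n : ℕ} (S : Finset (Fin n)) (a : Fin n → A) : TensorAlgebra K (Words K A) :=
  if h : S.Nonempty then
    TensorAlgebra.ι K (DirectSum.lof K ℕ+ (fun n : ℕ+ => ⨂[K]^(n : ℕ) A)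
      ⟨S.card, h.card_pos⟩ (subword K S a))
  else 1

theorem multilinearOn_wordAt {n : ℕ} (S : Finset (Fin n)) :
    MultilinearOn K S (wordAt K A S) := by
  by_cases h : S.Nonempty
  · obtain ⟨h1, h2, h3⟩ := multilinearOn_subword (K := K) (A := A) S
    refine ⟨fun i hi a x y => ?_, fun i hi a c x => ?_, fun i hi a x => ?_⟩
    · simp only [wordAt, dif_pos h, h1 i hi]
      exact map_add (TensorAlgebra.ι K ∘ₗ DirectSum.lof K ℕ+ (fun n : ℕ+ => ⨂[K]^(n : ℕ) A)
        ⟨S.card, h.card_pos⟩) _ _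
    · simp only [wordAt, dif_pos h, h2 i hi]
      exact map_smul (TensorAlgebra.ι K ∘ₗ DirectSum.lof K ℕ+ (fun n : ℕ+ => ⨂[K]^(n : ℕ) A)
        ⟨S.card, h.card_pos⟩) _ _
    · simp only [wordAt, dif_pos h, h3 i hi]
  · obtain rfl := Finset.not_nonempty_iff_eq_empty.1 h
    exact ⟨by simp, by simp, fun i _ a x => by simp [wordAt]⟩

/-- `Δ(a₁ ⋯ aₙ) = ∑_{S ⊆ [n]} a_S ⊗ (a_{J₁} | ⋯ | a_{Jₖ})`. -/
def wordsCoproduct : Words K A →ₗ[K]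
    TensorAlgebra K (Words K A) ⊗[K] TensorAlgebra K (Words K A) :=
  DirectSum.toModule K ℕ+ _ fun n => PiTensorProduct.lift
    (∑ S : Finset (Fin n), coproductTerm (wordAt K A) (multilinearOn_wordAt K A) S)

/-- `Δ⁺_≺(a₁ ⋯ aₙ) = ∑_{1 ∈ S ⊆ [n]} a_S ⊗ (a_{J₁} | ⋯ | a_{Jₖ})`. -/
def wordsLeftPlus : Words K A →ₗ[K]
    TensorAlgebra K (Words K A) ⊗[K] TensorAlgebra K (Words K A) :=
  DirectSum.toModule K ℕ+ _ fun n => PiTensorProduct.lift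
    (∑ S ∈ Finset.univ.filter (fun S : Finset (Fin n) => (⟨0, n.pos⟩ : Fin n) ∈ S),
      coproductTerm (wordAt K A) (multilinearOn_wordAt K A) S)

/-- The left half-coproduct `Δ_≺` of the double tensor algebra. -/
def wordsLeftHalf : TensorAlgebra K (Words K A) →ₗ[K]
    TensorAlgebra K (Words K A) ⊗[K] TensorAlgebra K (Words K A) :=
  leftHalf (wordsLeftPlus K A) (wordsCoproduct K A)

end DoubleTensor

/-! ## Non-crossing partitions -/

/-- A non-crossing partition of `[n]`, given by its equivalence relation `∼_L`, whose classes are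
the blocks: there are no `p₁ < q₁ < p₂ < q₂` with `p₁ ∼ p₂ ≁ q₁ ∼ q₂`. -/
structure NCPartition (n : ℕ) where
  rel : Setoid (Fin n)
  noncrossing : ∀ p₁ q₁ p₂ q₂ : Fin n, p₁ < q₁ → q₁ < p₂ → p₂ < q₂ →
    ¬ (rel p₁ p₂ ∧ ¬ rel p₂ q₁ ∧ rel q₁ q₂)

theorem NCPartition.rel_injective (n : ℕ) :
    Function.Injective (fun L : NCPartition n => fun i j => L.rel i j) := by
  rintro ⟨r, hr⟩ ⟨s, hs⟩ h
  have : r = s := Setoid.ext fun i j => iff_of_eq (congrFun (congrFun h i) j)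
  subst this
  rfl

instance NCPartition.instFintype (n : ℕ) : Fintype (NCPartition n) :=
  have : Finite (NCPartition n) := Finite.of_injective _ (NCPartition.rel_injective n)
  Fintype.ofFinite _

namespace NCPartition

variable {n : ℕ}

/-- The standardization of the restriction of `L` to a subset `S` of `[n]`. -/
def restrict (L : NCPartition n) (S : Finset (Fin n)) : NCPartition S.card where
  rel := L.rel.comap (S.orderEmbOfFin rfl)
  noncrossing _ _ _ _ h₁ h₂ h₃ := L.noncrossing _ _ _ _
    ((S.orderEmbOfFin rfl).lt_iff_lt.2 h₁) ((S.orderEmbOfFin rfl).lt_iff_lt.2 h₂)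
    ((S.orderEmbOfFin rfl).lt_iff_lt.2 h₃)

/-- The block of `i` lies strictly inside the block of `j`: every `m` in the block of `i` satisfies
`inf < m < sup` for the least and greatest elements `inf`, `sup` of the block of `j`. -/
def Nested (L : NCPartition n) (i j : Fin n) : Prop :=
  ∀ m, L.rel i m → (∃ u, L.rel j u ∧ u < m) ∧ (∃ v, L.rel j v ∧ m < v)

/-- The splittings of the set of blocks of `L` into two subsets `Q` and `U` are given by the
union `S ⊆ [n]` of the blocks of `Q`, an arbitrary union of blocks of `L`.  The splitting is
admissible if no block of `Q` lies strictly inside a block of `U`. -/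
def Admissible (L : NCPartition n) (S : Finset (Fin n)) : Prop :=
  (∀ i j, L.rel i j → i ∈ S → j ∈ S) ∧ ∀ q ∈ S, ∀ t, t ∉ S → ¬ L.Nested q t

end NCPartition

/-- The decorated non-crossing partitions of positive degree: the sum over `n > 0` of the spaces
`NC_n ⊗ A^{⊗ n}`.  The degree zero part `K` of the space of all decorated non-crossing partitions is
identified with the scalars of the tensor algebra. -/
abbrev DecoratedNC (K : Type*) [Field K] (A : Type*) [AddCommMonoid A] [Module K A] : Type _ :=
  ⨁ n : ℕ+, (NCPartition n →₀ K) ⊗[K] ⨂[K]^(n : ℕ) A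

section DoubleNC

variable (K : Type*) [Field K] (A : Type*) [AddCommMonoid A] [Module K A]

/-- The decorated non-crossing partition `L ⊗ w`, `L` a non-crossing partition of `[n]`. -/
def decorate (n : ℕ+) (L : NCPartition n) : (⨂[K]^(n : ℕ) A) →ₗ[K] DecoratedNC K A :=
  DirectSum.lof K ℕ+ (fun n : ℕ+ => (NCPartition n →₀ K) ⊗[K] ⨂[K]^(n : ℕ) A) n ∘ₗ
    TensorProduct.mk K _ _ (Finsupp.single L 1)

/-- The element `st(L|_S) ⊗ a_S`, as a generator of the tensor algebra; it is `1` for `S = ∅`. -/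
def decoratedAt {n : ℕ} (L : NCPartition n) (S : Finset (Fin n)) (a : Fin n → A) :
    TensorAlgebra K (DecoratedNC K A) :=
  if h : S.Nonempty then
    TensorAlgebra.ι K (decorate K A ⟨S.card, h.card_pos⟩ (L.restrict S) (subword K S a))
  else 1

theorem multilinearOn_decoratedAt {n : ℕ} (L : NCPartition n) (S : Finset (Fin n)) :
    MultilinearOn K S (decoratedAt K A L S) := by
  by_cases h : S.Nonempty
  · obtain ⟨h1, h2, h3⟩ := multilinearOn_subword (K := K) (A := A) S
    refine ⟨fun i hi a x y => ?_, fun i hi a c x => ?_, fun i hi a x => ?_⟩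
    · simp only [decoratedAt, dif_pos h, h1 i hi]
      exact map_add (TensorAlgebra.ι K ∘ₗ decorate K A ⟨S.card, h.card_pos⟩
        (L.restrict S)) _ _
    · simp only [decoratedAt, dif_pos h, h2 i hi]
      exact map_smul (TensorAlgebra.ι K ∘ₗ decorate K A ⟨S.card, h.card_pos⟩
        (L.restrict S)) _ _
    · simp only [decoratedAt, dif_pos h, h3 i hi]
  · obtain rfl := Finset.not_nonempty_iff_eq_empty.1 h
    exact ⟨by simp, by simp, fun i _ a x => by simp [decoratedAt]⟩

/-- The linear map on decorated non-crossing partitions with value on `L ⊗ (a₁ ⋯ aₙ)` the sum of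
`(st(Q) ⊗ a_Q) ⊗ (st(J₁^{L,Q}) ⊗ a_{J₁} | ⋯ | st(Jₖ^{L,Q}) ⊗ a_{Jₖ})` over the family `P n L` of
splittings of the blocks of `L`, given by the union `S` of the blocks of `Q`. -/
def ncSum (P : ∀ n : ℕ+, NCPartition n → Finset (Finset (Fin n))) : DecoratedNC K A →ₗ[K]
    TensorAlgebra K (DecoratedNC K A) ⊗[K] TensorAlgebra K (DecoratedNC K A) :=
  DirectSum.toModule K ℕ+ _ fun n => TensorProduct.lift
    (Finsupp.lift _ K _ fun L => PiTensorProduct.lift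
      (∑ S ∈ P n L, coproductTerm (decoratedAt K A L) (multilinearOn_decoratedAt K A L) S))

open Classical in
/-- The coproduct `Δ` on decorated non-crossing partitions: the sum over admissible splittings. -/
def ncCoproduct : DecoratedNC K A →ₗ[K]
    TensorAlgebra K (DecoratedNC K A) ⊗[K] TensorAlgebra K (DecoratedNC K A) :=
  ncSum K A fun _ L => Finset.univ.filter fun S => L.Admissible S

open Classical in
/-- `Δ⁺_≺` on decorated non-crossing partitions: the sum over admissible splittings such that `1`
belongs to a block of `Q`. -/
def ncLeftPlus : DecoratedNC K A →ₗ[K]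
    TensorAlgebra K (DecoratedNC K A) ⊗[K] TensorAlgebra K (DecoratedNC K A) :=
  ncSum K A fun n L => Finset.univ.filter fun S => L.Admissible S ∧ (⟨0, n.pos⟩ : Fin n) ∈ S

theorem ncSum_decorate (P : ∀ n : ℕ+, NCPartition n → Finset (Finset (Fin n))) (n : ℕ+)
    (L : NCPartition n) (a : Fin n → A) :
    ncSum K A P (decorate K A n L (PiTensorProduct.tprod K a)) = ∑ S ∈ P n L,
      decoratedAt K A L S a ⊗ₜ[K] ((components S).map fun J => decoratedAt K A L J a).prod := by
  simp [ncSum, decorate, coproductTerm_apply]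

/-- The left half-coproduct `Δ_≺` of the tensor algebra over decorated non-crossing partitions. -/
def ncLeftHalf : TensorAlgebra K (DecoratedNC K A) →ₗ[K]
    TensorAlgebra K (DecoratedNC K A) ⊗[K] TensorAlgebra K (DecoratedNC K A) :=
  leftHalf (ncLeftPlus K A) (ncCoproduct K A)

/-! ## The splitting map -/

/-- `Sp(a₁ ⋯ aₙ) = ∑_{L ∈ NC_n} L ⊗ (a₁ ⋯ aₙ)`. -/
def splitWords : Words K A →ₗ[K] DecoratedNC K A :=
  DirectSum.toModule K ℕ+ _ fun n => ∑ L : NCPartition n, decorate K A n L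

/-- The multiplicative unital extension of the splitting map. -/
def split : TensorAlgebra K (Words K A) →ₐ[K] TensorAlgebra K (DecoratedNC K A) :=
  TensorAlgebra.lift K (TensorAlgebra.ι K ∘ₗ splitWords K A)

/-- The dual splitting map `Sp^*(f) = f ∘ Sp`. -/
def splitDual : Module.Dual K (TensorAlgebra K (DecoratedNC K A)) →ₗ[K]
    Module.Dual K (TensorAlgebra K (Words K A)) :=
  (split K A).toLinearMap.dualMap

end DoubleNC

end SplittingProcess

end

open SplittingProcess

/-! For an infinitesimal character κ, the correction -w ⊗ 1 in Δ_≺ and the convention f ≺ e = f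
compensate each other: κ ≺ g = (κ ⊗ g) ∘ Δ⁺_≺ for every form g (`prec_eq_precPlus`). This is a
linear operator R in g. On a generator, the left factors of Δ⁺_≺ are single generators, and κ kills
products, so in a word v | x only the first letter is split: R g (v | x) = (κ ⊗ g)(Δ⁺_≺(v) (1 ⊗ x))
(`precPlus_ι_mul`). Thus R g is computed from values of g in smaller total degree. Hence Φ = e + R Φ
has exactly one solution, the Neumann series exp^≺(κ) (`eq_precExp_iff`). By the same formula, the
defect a ↦ Φ(a b) - Φ(a) Φ(b) is a fixed point of R, so it vanishes and Φ is a character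
(`mem_characters_of_eq`).

Conversely, for a character Φ the equation only has to be solved on generators. There it expresses
κ(v) through Φ and values of κ in smaller degree, so a second recursion on the degree gives
existence and uniqueness of κ (`existsUnique_eq_add`). Counit laws and degrees suffice for all this;
coassociativity does not enter, and both tensor algebras are covered at once.

For Sp the point is that it intertwines the coproducts. Given S, the partitions L for which S is
admissible correspond bijectively to a partition of S together with one of each component of the
complement (`exists_admissible_restrict_eq`, `Admissible.eq_of_restrict_eq`). Then Sp^* transports
the fixed-point equation, and uniqueness over words identifies the image with an exponential. -/

noncomputable section

namespace SplittingProcess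

/-! ## Locally nilpotent operators on a dual space -/

section LocallyNilpotent

variable {K : Type*} [Field K] {W : Type*} [AddCommMonoid W] [Module K W]

/-- An operator `R` on the dual of `W` is locally nilpotent along the sets `s 0 ⊆ s 1 ⊆ ⋯`, which
span `W`, if it maps forms vanishing on `s n` to forms vanishing on `s (n + 1)`. -/
structure LocallyNilpotent (s : ℕ → Set W) (R : Module.End K (Module.Dual K W)) : Prop where
  mono : Monotone s
  -- Emptiness of `s 0` makes the base case vacuous: `R f` vanishes on `s 1` for every `f`, and `R ^
  -- n` applied to any form vanishes on `s n`.
  zero : s 0 = ∅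
  span : Submodule.span K (⋃ n, s n) = ⊤
  step : ∀ n f, (∀ w ∈ s n, f w = 0) → ∀ w ∈ s (n + 1), R f w = 0

namespace LocallyNilpotent

variable {s : ℕ → Set W} {R : Module.End K (Module.Dual K W)}

theorem pow_apply_eq_zero (h : LocallyNilpotent s R) (f : Module.Dual K W) (n : ℕ) :
    ∀ w ∈ s n, (R ^ n) f w = 0 := by
  induction n with
  | zero => simp [h.zero]
  | succ n ih =>
    rw [pow_succ']
    exact h.step n _ ih

theorem finite_support (h : LocallyNilpotent s R) (f : Module.Dual K W) (x : W) :
    (Function.support fun n : ℕ => (R ^ n) f x).Finite := by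
  have hx : x ∈ Submodule.span K (⋃ n, s n) := h.span ▸ Submodule.mem_top
  induction hx using Submodule.span_induction with
  | mem x hx =>
    obtain ⟨N, hN⟩ := Set.mem_iUnion.1 hx
    refine (Set.finite_lt_nat N).subset fun n hn => ?_
    by_contra hlt
    exact hn (h.pow_apply_eq_zero f n x (h.mono (not_lt.1 hlt) hN))
  | zero => simp
  | add x y _ _ hx hy =>
    refine (hx.union hy).subset ?_
    simpa using Function.support_add (fun n : ℕ => (R ^ n) f x) fun n => (R ^ n) f y
  | smul c x _ hx =>
    refine hx.subset fun n hn => ?_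
    simp only [Function.mem_support, map_smul, smul_eq_mul] at hn ⊢
    exact right_ne_zero_of_mul hn

theorem ext_of_forall_mem (h : LocallyNilpotent s R) {f g : Module.Dual K W}
    (hfg : ∀ n, ∀ w ∈ s n, f w = g w) : f = g :=
  LinearMap.ext_on h.span fun _ hw => by
    obtain ⟨n, hn⟩ := Set.mem_iUnion.1 hw
    exact hfg n _ hn

/-- Vanishing on `s n` propagates through `f = R f` to `s (n + 1)`. Besides uniqueness of solutions,
this yields the multiplicativity of exponentials. -/
theorem eq_zero_of_fixed (h : LocallyNilpotent s R) {f : Module.Dual K W} (hf : f = R f) :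
    f = 0 := by
  refine h.ext_of_forall_mem fun n => ?_
  induction n with
  | zero => simp [h.zero]
  | succ n ih =>
    rw [hf]
    exact h.step n f ih

theorem unique (h : LocallyNilpotent s R) {f g g' : Module.Dual K W} (hg : g = f + R g)
    (hg' : g' = f + R g') : g = g' := by
  refine sub_eq_zero.1 (h.eq_zero_of_fixed ?_)
  rw [map_sub]
  nth_rewrite 1 [hg, hg']
  abel

/-- On `s N` the Neumann series agrees with its first N terms. Stating this for any `g` with these
pointwise values makes it applicable to `precExp`. -/
theorem eq_add_of_eq_finsum (h : LocallyNilpotent s R) {f g : Module.Dual K W}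
    (hg : ∀ x, g x = ∑ᶠ n : ℕ, (R ^ n) f x) : g = f + R g := by
  have hpart : ∀ N, ∀ w ∈ s N, g w = (∑ n ∈ Finset.range N, (R ^ n) f) w := by
    intro N w hw
    rw [hg, LinearMap.sum_apply]
    refine finsum_eq_sum_of_support_subset _ fun n hn => ?_
    by_contra hlt
    simp only [Finset.coe_range, Set.mem_Iio, not_lt] at hlt
    exact hn (h.pow_apply_eq_zero f n w (h.mono hlt hw))
  refine h.ext_of_forall_mem fun N w hw => ?_
  -- One more term than `s N` requires is kept, so that removing the term n = 0 leaves `R` of the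
  -- sum of N terms.
  have h1 := hpart (N + 1) w (h.mono N.le_succ hw)
  have h2 := h.step N (g - ∑ n ∈ Finset.range N, (R ^ n) f)
    (fun w hw => by rw [LinearMap.sub_apply, hpart N w hw, sub_self]) w (h.mono N.le_succ hw)
  rw [map_sub, LinearMap.sub_apply, sub_eq_zero, map_sum] at h2
  rw [h1, Finset.sum_range_succ', LinearMap.add_apply, LinearMap.add_apply, h2, add_comm]
  simp [pow_succ']

theorem exists_eq_add (h : LocallyNilpotent s R) (f : Module.Dual K W) :
    ∃ g : Module.Dual K W, g = f + R g :=
  ⟨{ toFun := fun x => ∑ᶠ n : ℕ, (R ^ n) f x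
     map_add' := fun x y => by
      simp only [map_add]
      exact finsum_add_distrib (h.finite_support f x) (h.finite_support f y)
     map_smul' := fun c x => by
      simp only [map_smul, RingHom.id_apply]
      exact (smul_finsum' c (h.finite_support f x)).symm }, h.eq_add_of_eq_finsum fun _ => rfl⟩

end LocallyNilpotent

end LocallyNilpotent

/-! ## Pairing of forms with tensors, and the half-shuffle product -/

section Generic

variable {K : Type*} [Field K] {V : Type*} [AddCommMonoid V] [Module K V]

theorem counit_one : counit K V 1 = 1 := by simp [counit]

theorem counit_ι (v : V) : counit K V (TensorAlgebra.ι K v) = 0 := by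
  simp [counit, TensorAlgebra.algebraMapInv]

theorem counit_mul (a b : TensorAlgebra K V) :
    counit K V (a * b) = counit K V a * counit K V b := by simp [counit]

/-- The form `a ⊗ b ↦ f(a) g(b)`. -/
def pair (f g : Module.Dual K (TensorAlgebra K V)) :
    Module.Dual K (TensorAlgebra K V ⊗[K] TensorAlgebra K V) :=
  LinearMap.mul' K K ∘ₗ TensorProduct.map f g

@[simp]
theorem pair_tmul (f g : Module.Dual K (TensorAlgebra K V)) (a b : TensorAlgebra K V) :
    pair f g (a ⊗ₜ b) = f a * g b := by simp [pair]

theorem pair_add_right (f g g' : Module.Dual K (TensorAlgebra K V)) :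
    pair f (g + g') = pair f g + pair f g' := by ext; simp [mul_add]

theorem pair_sub_right (f g g' : Module.Dual K (TensorAlgebra K V)) :
    pair f (g - g') = pair f g - pair f g' := by ext; simp [mul_sub]

theorem pair_smul_right (f g : Module.Dual K (TensorAlgebra K V)) (c : K) :
    pair f (c • g) = c • pair f g := by ext; simp [mul_left_comm]

/-- The contraction `a ⊗ b ↦ e(b) a`. -/
def contractRight (K : Type*) [Field K] (V : Type*) [AddCommMonoid V] [Module K V] :
    TensorAlgebra K V ⊗[K] TensorAlgebra K V →ₐ[K] TensorAlgebra K V :=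
  (Algebra.TensorProduct.rid K K (TensorAlgebra K V)).toAlgHom.comp
    (Algebra.TensorProduct.map (AlgHom.id K _) TensorAlgebra.algebraMapInv)

@[simp]
theorem contractRight_tmul (a b : TensorAlgebra K V) :
    contractRight K V (a ⊗ₜ b) = counit K V b • a := by
  simp [contractRight, counit]

/-- The contraction `a ⊗ b ↦ e(a) b`. -/
def contractLeft (K : Type*) [Field K] (V : Type*) [AddCommMonoid V] [Module K V] :
    TensorAlgebra K V ⊗[K] TensorAlgebra K V →ₐ[K] TensorAlgebra K V :=
  (Algebra.TensorProduct.lid K (TensorAlgebra K V)).toAlgHom.comp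
    (Algebra.TensorProduct.map TensorAlgebra.algebraMapInv (AlgHom.id K _))

@[simp]
theorem contractLeft_tmul (a b : TensorAlgebra K V) :
    contractLeft K V (a ⊗ₜ b) = counit K V a • b := by
  simp [contractLeft, counit]

/-- Turns pairings with e into counit laws for the coproducts. -/
theorem pair_counit_right (f : Module.Dual K (TensorAlgebra K V))
    (t : TensorAlgebra K V ⊗[K] TensorAlgebra K V) :
    pair f (counit K V) t = f (contractRight K V t) := by
  induction t with
  | zero => simp
  | tmul a b => simp [mul_comm]
  | add x y hx hy => simp [hx, hy]

/-- The first letter is isolated because the half-coproduct treats it differently from the others: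
its values are known on 1 and on products v | y. -/
theorem mem_span_one_ι_mul (x : TensorAlgebra K V) :
    x ∈ Submodule.span K ({1} ∪ Set.range fun p : V × TensorAlgebra K V =>
      TensorAlgebra.ι K p.1 * p.2) := by
  set M := Submodule.span K ({1} ∪ Set.range fun p : V × TensorAlgebra K V =>
      TensorAlgebra.ι K p.1 * p.2) with hM
  have h1 : (1 : TensorAlgebra K V) ∈ M := Submodule.subset_span (by simp)
  have h2 : ∀ v y, TensorAlgebra.ι K v * y ∈ M := fun v y =>
    Submodule.subset_span (Or.inr ⟨(v, y), rfl⟩)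
  induction x using TensorAlgebra.induction with
  | algebraMap r => rw [Algebra.algebraMap_eq_smul_one]; exact M.smul_mem _ h1
  | ι v => simpa using h2 v 1
  | add a b ha hb => exact M.add_mem ha hb
  | mul a b ha hb =>
    clear_value M
    rw [hM] at ha
    induction ha using Submodule.span_induction with
    | mem a ha =>
      rcases ha with rfl | ⟨⟨v, y⟩, rfl⟩
      · simpa using hb
      · simpa [mul_assoc] using h2 v (y * b)
    | zero => simp
    | add a a' _ _ ha ha' => rw [add_mul]; exact M.add_mem ha ha'
    | smul c a _ ha => rw [smul_mul_assoc]; exact M.smul_mem _ ha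

/-- Linear maps on a tensor algebra agree if they agree on `1` and on the products `v | y`. -/
theorem linearMap_ext_ι_mul {E : Type*} [AddCommMonoid E] [Module K E]
    {f g : TensorAlgebra K V →ₗ[K] E} (h1 : f 1 = g 1)
    (h2 : ∀ v y, f (TensorAlgebra.ι K v * y) = g (TensorAlgebra.ι K v * y)) : f = g := by
  refine LinearMap.ext_on (top_le_iff.1 fun x _ => mem_span_one_ι_mul x) ?_
  rintro _ (rfl | ⟨⟨v, y⟩, rfl⟩)
  · exact h1
  · exact h2 v y

/-- Each factor is a scalar plus an element of the augmentation ideal, and Φ(1) = 1 takes care of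
the scalars. -/
theorem characters.map_mul {Φ : Module.Dual K (TensorAlgebra K V)} (hΦ : Φ ∈ characters K V)
    (a b : TensorAlgebra K V) : Φ (a * b) = Φ a * Φ b := by
  have key : ∀ x : TensorAlgebra K V, ∃ r : K, ∃ y, counit K V y = 0 ∧ x = r • 1 + y := fun x =>
    ⟨counit K V x, x - counit K V x • 1, by simp [counit_one], by simp⟩
  obtain ⟨r, a, ha, rfl⟩ := key a
  obtain ⟨t, b, hb, rfl⟩ := key b
  simp only [add_mul, mul_add, map_add, smul_mul_assoc, mul_smul_comm, one_mul, mul_one, map_smul,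
    hΦ.1, hΦ.2 a b ha hb, smul_eq_mul]
  ring

/-- Infinitesimal characters are the derivations with respect to e. -/
theorem infinitesimalCharacters.map_mul {κ : Module.Dual K (TensorAlgebra K V)}
    (hκ : κ ∈ infinitesimalCharacters K V) (a b : TensorAlgebra K V) :
    κ (a * b) = κ a * counit K V b + counit K V a * κ b := by
  have key : ∀ x : TensorAlgebra K V, ∃ r : K, ∃ y, counit K V y = 0 ∧ x = r • 1 + y := fun x =>
    ⟨counit K V x, x - counit K V x • 1, by simp [counit_one], by simp⟩
  obtain ⟨r, a, ha, rfl⟩ := key a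
  obtain ⟨t, b, hb, rfl⟩ := key b
  simp only [add_mul, mul_add, map_add, smul_mul_assoc, mul_smul_comm, one_mul, mul_one, map_smul,
    hκ.1, hκ.2 a b ha hb, smul_eq_mul, counit_one, ha, hb]
  ring

theorem infinitesimalCharacters.ext {κ κ' : Module.Dual K (TensorAlgebra K V)}
    (hκ : κ ∈ infinitesimalCharacters K V) (hκ' : κ' ∈ infinitesimalCharacters K V)
    (h : ∀ v, κ (TensorAlgebra.ι K v) = κ' (TensorAlgebra.ι K v)) : κ = κ' :=
  linearMap_ext_ι_mul (by rw [hκ.1, hκ'.1]) fun v y => by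
    rw [infinitesimalCharacters.map_mul hκ, infinitesimalCharacters.map_mul hκ', h, counit_ι]
    simp

/-- The infinitesimal character with given values on the generators. -/
def infinitesimalExtension (K : Type*) [Field K] (V : Type*) [AddCommMonoid V] [Module K V] :
    Module.Dual K V →ₗ[K] Module.Dual K (TensorAlgebra K V) :=
  (TensorAlgebra.ιInv (R := K) (M := V)).dualMap

theorem infinitesimalExtension_ι (k : Module.Dual K V) (v : V) :
    infinitesimalExtension K V k (TensorAlgebra.ι K v) = k v :=
  congrArg k (TensorAlgebra.ι_leftInverse v)

/-- The projection `TensorAlgebra.ιInv` is the second component of an algebra morphism to the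
square-zero extension K ⊕ V whose first component is e; there, two elements with zero first
component have product zero. -/
theorem infinitesimalExtension_mem (k : Module.Dual K V) :
    infinitesimalExtension K V k ∈ infinitesimalCharacters K V := by
  -- The same right action as in the definition of `TensorAlgebra.ιInv`, so that `hInv` holds by
  -- `rfl`.
  let : Module Kᵐᵒᵖ V := Module.compHom _ ((RingHom.id K).fromOpposite mul_comm)
  have : IsCentralScalar K V := ⟨fun r m => rfl⟩
  have hfst : ∀ a : TensorAlgebra K V,
      (TensorAlgebra.toTrivSqZeroExt a : TrivSqZeroExt K V).fst = counit K V a := fun a => by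
    have : (TrivSqZeroExt.fstHom K K V).comp TensorAlgebra.toTrivSqZeroExt =
        TensorAlgebra.algebraMapInv (R := K) (M := V) := by
      ext v; simp [TensorAlgebra.algebraMapInv]
    exact DFunLike.congr_fun this a
  have hInv : ∀ a : TensorAlgebra K V, infinitesimalExtension K V k a =
    k (TensorAlgebra.toTrivSqZeroExt a : TrivSqZeroExt K V).snd := fun a => rfl
  refine ⟨by simp [hInv], fun a b ha hb => ?_⟩
  simp [hInv, hfst, ha, hb]

/-! ### The operator of left half-shuffling by κ, and its lowering of the degree. -/

variable {δplus δ : V →ₗ[K] TensorAlgebra K V ⊗[K] TensorAlgebra K V}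

/-- The operator `g ↦ m ∘ (κ ⊗ g) ∘ Δ⁺_≺` on linear forms. -/
def precPlus (δplus δ : V →ₗ[K] TensorAlgebra K V ⊗[K] TensorAlgebra K V)
    (κ : Module.Dual K (TensorAlgebra K V)) :
    Module.End K (Module.Dual K (TensorAlgebra K V)) where
  toFun g := pair κ g ∘ₗ leftHalfPlus δplus δ
  map_add' g g' := by rw [pair_add_right, LinearMap.add_comp]
  map_smul' c g := by rw [pair_smul_right, LinearMap.smul_comp]; rfl

theorem precPlus_apply (κ g : Module.Dual K (TensorAlgebra K V)) (x : TensorAlgebra K V) :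
    precPlus δplus δ κ g x = pair κ g (leftHalfPlus δplus δ x) := rfl

theorem precPlus_apply_one (κ g : Module.Dual K (TensorAlgebra K V)) :
    precPlus δplus δ κ g 1 = 0 := by simp [precPlus_apply, leftHalfPlus_one]

/-- The half-coproduct is given on generators `v`, which are spanned by the elements `gen g` of
degree `deg g > 0`, by `v ⊗ 1` plus terms of smaller degree in both factors, and the counit laws
hold. -/
structure GradedGenerators (δplus δ : V →ₗ[K] TensorAlgebra K V ⊗[K] TensorAlgebra K V)
    {G : Type*} (gen : G → V) (deg : G → ℕ) : Prop where
  deg_pos : ∀ g, 0 < deg g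
  span_range : Submodule.span K (Set.range gen) = ⊤
  contractRight_plus : ∀ g, contractRight K V (δplus (gen g)) = TensorAlgebra.ι K (gen g)
  contractRight_coproduct : ∀ g, contractRight K V (δ (gen g)) = TensorAlgebra.ι K (gen g)
  contractLeft_coproduct : ∀ g, contractLeft K V (δ (gen g)) = TensorAlgebra.ι K (gen g)
  -- The drop of degree in the right factor drives the exponential, the one in the left factor the
  -- logarithm.
  plus_sub_mem : ∀ g, δplus (gen g) - TensorAlgebra.ι K (gen g) ⊗ₜ 1 ∈ Submodule.span K
    {t | ∃ (p : G) (l : List G), deg p < deg g ∧ (l.map deg).sum < deg g ∧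
      t = TensorAlgebra.ι K (gen p) ⊗ₜ (l.map fun q => TensorAlgebra.ι K (gen q)).prod}

namespace GradedGenerators

variable {G : Type*} {gen : G → V} {deg : G → ℕ}

theorem linearMap_ext (h : GradedGenerators δplus δ gen deg) {E : Type*} [AddCommMonoid E]
    [Module K E] {f f' : V →ₗ[K] E} (hf : ∀ g, f (gen g) = f' (gen g)) : f = f' :=
  LinearMap.ext_on_range h.span_range hf

theorem contractRight_coproduct_apply (h : GradedGenerators δplus δ gen deg)
    (x : TensorAlgebra K V) : contractRight K V (coproduct δ x) = x := by
  have : (contractRight K V).comp (coproduct δ) = AlgHom.id K _ := by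
    apply TensorAlgebra.hom_ext
    refine h.linearMap_ext fun g => ?_
    simpa [coproduct] using h.contractRight_coproduct g
  exact DFunLike.congr_fun this x

theorem contractLeft_coproduct_apply (h : GradedGenerators δplus δ gen deg)
    (x : TensorAlgebra K V) : contractLeft K V (coproduct δ x) = x := by
  have : (contractLeft K V).comp (coproduct δ) = AlgHom.id K _ := by
    apply TensorAlgebra.hom_ext
    refine h.linearMap_ext fun g => ?_
    simpa [coproduct] using h.contractLeft_coproduct g
  exact DFunLike.congr_fun this x

theorem contractRight_leftHalfPlus (h : GradedGenerators δplus δ gen deg)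
    (x : TensorAlgebra K V) :
    contractRight K V (leftHalfPlus δplus δ x) = x - counit K V x • 1 := by
  have hv : ∀ v, contractRight K V (δplus v) = TensorAlgebra.ι K v := fun v =>
    DFunLike.congr_fun (h.linearMap_ext (f := (contractRight K V).toLinearMap ∘ₗ δplus)
      (f' := TensorAlgebra.ι K) h.contractRight_plus) v
  have : (contractRight K V).toLinearMap ∘ₗ leftHalfPlus δplus δ =
      LinearMap.id - (counit K V).smulRight 1 := by
    refine linearMap_ext_ι_mul ?_ fun v y => ?_
    · simp [leftHalfPlus_one, counit_one]
    · simp [leftHalfPlus_ι_mul, hv, h.contractRight_coproduct_apply, counit_mul, counit_ι]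
  exact DFunLike.congr_fun this x

/-- Write g = g° + g(1) e. The form g° vanishes at 1, so it does not see the term w ⊗ 1 removed from
Δ⁺_≺, while (κ ⊗ e) ∘ Δ⁺_≺ = κ by the right counit law, which is the convention κ ≺ e = κ. -/
theorem prec_eq_precPlus (h : GradedGenerators δplus δ gen deg)
    {κ : Module.Dual K (TensorAlgebra K V)} (hκ : κ 1 = 0)
    (g : Module.Dual K (TensorAlgebra K V)) :
    prec (leftHalf δplus δ) κ g = precPlus δplus δ κ g := by
  have hred : reducedForm κ = κ := by simp [reducedForm, hκ]
  ext x
  have h1 : prec (leftHalf δplus δ) κ g x =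
      pair κ (reducedForm g) (leftHalf δplus δ x) + g 1 * κ x := by
    simp [prec, hred, pair]
  have h2 : reducedForm g 1 = 0 := by simp [reducedForm, counit_one]
  rw [h1, precPlus_apply, leftHalf, LinearMap.sub_apply, map_sub]
  simp only [LinearMap.comp_apply, LinearMap.flip_apply, TensorProduct.mk_apply, pair_tmul, h2,
    mul_zero, sub_zero]
  rw [reducedForm, pair_sub_right, pair_smul_right, LinearMap.sub_apply, LinearMap.smul_apply,
    pair_counit_right, h.contractRight_leftHalfPlus]
  simp [hκ]

theorem plus_mem_span (h : GradedGenerators δplus δ gen deg) (v : V) :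
    δplus v ∈ Submodule.span K (Set.range fun p : V × TensorAlgebra K V =>
      TensorAlgebra.ι K p.1 ⊗ₜ[K] p.2) := by
  have hv : v ∈ Submodule.span K (Set.range gen) := h.span_range ▸ Submodule.mem_top
  induction hv using Submodule.span_induction with
  | mem v hv =>
    obtain ⟨g, rfl⟩ := hv
    rw [← sub_add_cancel (δplus (gen g)) (TensorAlgebra.ι K (gen g) ⊗ₜ 1)]
    refine Submodule.add_mem _ (Submodule.span_mono ?_ (h.plus_sub_mem g))
      (Submodule.subset_span ⟨(gen g, 1), rfl⟩)
    rintro _ ⟨p, l, -, -, rfl⟩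
    exact ⟨(gen p, _), rfl⟩
  | zero => simp
  | add a b _ _ ha hb => rw [map_add]; exact Submodule.add_mem _ ha hb
  | smul c a _ ha => rw [map_smul]; exact Submodule.smul_mem _ _ ha

/-- Since κ(u | a) = κ(u) e(a), the left factor of `t` contributes only through its augmentation. -/
theorem pair_ι_tmul_mul {κ : Module.Dual K (TensorAlgebra K V)}
    (hκ : κ ∈ infinitesimalCharacters K V) (g : Module.Dual K (TensorAlgebra K V)) (u : V)
    (y : TensorAlgebra K V) (t : TensorAlgebra K V ⊗[K] TensorAlgebra K V) :
    pair κ g ((TensorAlgebra.ι K u ⊗ₜ y) * t) =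
      κ (TensorAlgebra.ι K u) * g (y * contractLeft K V t) := by
  induction t with
  | zero => simp
  | tmul a b => simp [infinitesimalCharacters.map_mul hκ, counit_ι, mul_assoc]
  | add a b ha hb => simp only [mul_add, map_add, ha, hb]

/-- By `plus_mem_span` the left factors of Δ⁺_≺(v) are single letters, so `pair_ι_tmul_mul` and the
left counit law replace Δ(x) by 1 ⊗ x. In particular the operator is compatible with right
multiplication. -/
theorem precPlus_ι_mul (h : GradedGenerators δplus δ gen deg)
    {κ : Module.Dual K (TensorAlgebra K V)} (hκ : κ ∈ infinitesimalCharacters K V)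
    (g : Module.Dual K (TensorAlgebra K V)) (v : V) (x : TensorAlgebra K V) :
    precPlus δplus δ κ g (TensorAlgebra.ι K v * x) = pair κ g (δplus v * (1 ⊗ₜ x)) := by
  rw [precPlus_apply, leftHalfPlus_ι_mul]
  have hv := h.plus_mem_span v
  generalize δplus v = t at hv ⊢
  induction hv using Submodule.span_induction with
  | mem s hs =>
    obtain ⟨⟨u, y⟩, rfl⟩ := hs
    simp [pair_ι_tmul_mul hκ, h.contractLeft_coproduct_apply]
  | zero => simp
  | add a b _ _ ha hb => simp only [add_mul, map_add, ha, hb]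
  | smul c a _ ha => simp only [smul_mul_assoc, map_smul, ha]

/-- The words in the generators of total degree less than `n`. -/
def wordsOfDegreeLT (K : Type*) [Field K] {V : Type*} [AddCommMonoid V] [Module K V]
    {G : Type*} (gen : G → V) (deg : G → ℕ) (n : ℕ) : Set (TensorAlgebra K V) :=
  {x | ∃ l : List G, (l.map deg).sum < n ∧ x = (l.map fun q => TensorAlgebra.ι K (gen q)).prod}

theorem span_iUnion_wordsOfDegreeLT (h : GradedGenerators δplus δ gen deg) :
    Submodule.span K (⋃ n, wordsOfDegreeLT K gen deg n) = ⊤ := by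
  set M := Submodule.span K (⋃ n, wordsOfDegreeLT K gen deg n) with hM
  have hl : ∀ l : List G, (l.map fun q => TensorAlgebra.ι K (gen q)).prod ∈ M := fun l =>
    Submodule.subset_span (Set.mem_iUnion.2 ⟨_, l, Nat.lt_succ_self _, rfl⟩)
  have hmul : ∀ a ∈ M, ∀ b ∈ M, a * b ∈ M := by
    intro a ha b hb
    have := Submodule.mul_mem_mul ha hb
    rw [hM, Submodule.span_mul_span] at this
    refine Submodule.span_le.2 ?_ this
    rintro _ ⟨a, ha, b, hb, rfl⟩
    obtain ⟨_, l, -, rfl⟩ := Set.mem_iUnion.1 ha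
    obtain ⟨_, l', -, rfl⟩ := Set.mem_iUnion.1 hb
    simpa using hl (l ++ l')
  have hι : ∀ v, TensorAlgebra.ι K v ∈ M := fun v => by
    have hv : v ∈ Submodule.span K (Set.range gen) := h.span_range ▸ Submodule.mem_top
    induction hv using Submodule.span_induction with
    | mem v hv =>
      obtain ⟨g, rfl⟩ := hv
      simpa using hl [g]
    | zero => simp
    | add a b _ _ ha hb => rw [map_add]; exact M.add_mem ha hb
    | smul c a _ ha => rw [map_smul]; exact M.smul_mem _ ha
  refine top_le_iff.1 fun x hx => ?_
  clear hx
  induction x using TensorAlgebra.induction with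
  | algebraMap r => rw [Algebra.algebraMap_eq_smul_one]; exact M.smul_mem _ (by simpa using hl [])
  | ι v => exact hι v
  | add a b ha hb => exact M.add_mem ha hb
  | mul a b ha hb => exact hmul a ha b hb

/-- On a word g | l, the term g ⊗ 1 evaluates the form on l, of smaller degree because deg g > 0;
every other term evaluates it on some l' | l with deg l' < deg g. -/
theorem locallyNilpotent_precPlus (h : GradedGenerators δplus δ gen deg)
    {κ : Module.Dual K (TensorAlgebra K V)} (hκ : κ ∈ infinitesimalCharacters K V) :
    LocallyNilpotent (wordsOfDegreeLT K gen deg) (precPlus δplus δ κ) where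
  mono m n hmn := by
    rintro _ ⟨l, hl, rfl⟩
    exact ⟨l, hl.trans_le hmn, rfl⟩
  zero := by simp [wordsOfDegreeLT]
  span := h.span_iUnion_wordsOfDegreeLT
  step n f hf := by
    rintro _ ⟨l, hl, rfl⟩
    cases l with
    | nil => simp [precPlus_apply_one]
    | cons g l =>
      simp only [List.map_cons, List.sum_cons] at hl
      have hg := h.deg_pos g
      rw [List.map_cons, List.prod_cons, h.precPlus_ι_mul hκ,
        ← sub_add_cancel (δplus (gen g)) (TensorAlgebra.ι K (gen g) ⊗ₜ 1), add_mul, map_add]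
      have h2 : f (l.map fun q => TensorAlgebra.ι K (gen q)).prod = 0 :=
        hf _ ⟨l, by omega, rfl⟩
      have h1 := h.plus_sub_mem g
      rw [Algebra.TensorProduct.tmul_mul_tmul, pair_tmul, one_mul, h2, mul_zero, add_zero]
      generalize δplus (gen g) - TensorAlgebra.ι K (gen g) ⊗ₜ 1 = t at h1 ⊢
      induction h1 using Submodule.span_induction with
      | mem t ht =>
        obtain ⟨p, l', -, hl', rfl⟩ := ht
        rw [Algebra.TensorProduct.tmul_mul_tmul, pair_tmul, ← List.prod_append, ← List.map_append,
          hf _ ⟨l' ++ l, by rw [List.map_append, List.sum_append]; omega, rfl⟩, mul_zero]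
      | zero => simp
      | add a b _ _ ha hb => simp [add_mul, ha, hb]
      | smul c a _ ha => simp [ha]

/-! ### The exponential as the solution of the fixed-point equation. -/

theorem precPow_eq (h : GradedGenerators δplus δ gen deg)
    {κ : Module.Dual K (TensorAlgebra K V)} (hκ : κ 1 = 0) (n : ℕ) :
    precPow (leftHalf δplus δ) κ n = (precPlus δplus δ κ ^ n) (counit K V) := by
  induction n with
  | zero => rfl
  | succ n ih => rw [precPow, ih, h.prec_eq_precPlus hκ, pow_succ']; rfl

theorem precExpConverges (h : GradedGenerators δplus δ gen deg)
    {κ : Module.Dual K (TensorAlgebra K V)} (hκ : κ ∈ infinitesimalCharacters K V) :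
    PrecExpConverges (leftHalf δplus δ) κ := fun x => by
  simpa only [h.precPow_eq hκ.1] using
    (h.locallyNilpotent_precPlus hκ).finite_support (counit K V) x

theorem eq_precExp_iff (h : GradedGenerators δplus δ gen deg)
    {κ : Module.Dual K (TensorAlgebra K V)} (hκ : κ ∈ infinitesimalCharacters K V)
    {Φ : Module.Dual K (TensorAlgebra K V)} :
    Φ = precExp (leftHalf δplus δ) κ ↔ Φ = counit K V + precPlus δplus δ κ Φ := by
  have hexp : precExp (leftHalf δplus δ) κ =
      counit K V + precPlus δplus δ κ (precExp (leftHalf δplus δ) κ) := by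
    refine (h.locallyNilpotent_precPlus hκ).eq_add_of_eq_finsum fun x => ?_
    rw [precExp, dif_pos (h.precExpConverges hκ)]
    exact finsum_congr fun n => by rw [h.precPow_eq hκ.1]
  exact ⟨fun hΦ => hΦ ▸ hexp, fun hΦ => (h.locallyNilpotent_precPlus hκ).unique hΦ hexp⟩

theorem pair_mul_one_tmul (κ g : Module.Dual K (TensorAlgebra K V)) (x : TensorAlgebra K V)
    (t : TensorAlgebra K V ⊗[K] TensorAlgebra K V) :
    pair κ g (t * (1 ⊗ₜ x)) = pair κ (g ∘ₗ LinearMap.mulRight K x) t := by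
  induction t with
  | zero => simp
  | tmul a b => simp
  | add a b ha hb => simp only [add_mul, map_add, ha, hb]

/-- For fixed b, the defect a ↦ Φ(a b) - Φ(b) Φ(a) vanishes at 1, and on v | y it satisfies the
homogeneous equation, since only v is split. A locally nilpotent operator has no nonzero fixed
point. -/
theorem mem_characters_of_eq (h : GradedGenerators δplus δ gen deg)
    {κ : Module.Dual K (TensorAlgebra K V)} (hκ : κ ∈ infinitesimalCharacters K V)
    {Φ : Module.Dual K (TensorAlgebra K V)} (hΦ : Φ = counit K V + precPlus δplus δ κ Φ) :
    Φ ∈ characters K V := by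
  have h1 : Φ 1 = 1 := by
    rw [hΦ, LinearMap.add_apply, precPlus_apply_one, counit_one, add_zero]
  have h2 : ∀ v y, Φ (TensorAlgebra.ι K v * y) = pair κ Φ (δplus v * (1 ⊗ₜ y)) := fun v y => by
    conv_lhs => rw [hΦ]
    rw [LinearMap.add_apply, counit_mul, counit_ι, zero_mul, zero_add, h.precPlus_ι_mul hκ]
  refine ⟨h1, fun a b _ _ => ?_⟩
  have hf : Φ ∘ₗ LinearMap.mulRight K b - Φ b • Φ = 0 := by
    refine (h.locallyNilpotent_precPlus hκ).eq_zero_of_fixed (linearMap_ext_ι_mul ?_ fun v y => ?_)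
    · simp [precPlus_apply_one, h1]
    · rw [h.precPlus_ι_mul hκ, pair_sub_right, pair_smul_right, LinearMap.sub_apply,
        LinearMap.sub_apply, LinearMap.smul_apply, LinearMap.smul_apply, ← pair_mul_one_tmul,
        LinearMap.comp_apply, LinearMap.mulRight_apply, mul_assoc, mul_assoc, h2, h2]
      simp
  simpa [sub_eq_zero, mul_comm] using DFunLike.congr_fun hf a

theorem precExp_mem_characters (h : GradedGenerators δplus δ gen deg)
    {κ : Module.Dual K (TensorAlgebra K V)} (hκ : κ ∈ infinitesimalCharacters K V) :
    precExp (leftHalf δplus δ) κ ∈ characters K V :=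
  h.mem_characters_of_eq hκ ((h.eq_precExp_iff hκ).1 rfl)

/-! ### The logarithm: recovering κ from a character. -/

/-- The operator `k ↦ -(κ ⊗ Φ) ∘ (Δ⁺_≺ - id ⊗ 1)` on forms on the generators, where `κ` is the
infinitesimal character extending `k`. -/
def logStep (δplus : V →ₗ[K] TensorAlgebra K V ⊗[K] TensorAlgebra K V)
    (Φ : Module.Dual K (TensorAlgebra K V)) : Module.End K (Module.Dual K V) where
  toFun k := -(pair (infinitesimalExtension K V k) Φ ∘ₗ
    (δplus - (TensorProduct.mk K _ _).flip 1 ∘ₗ TensorAlgebra.ι K))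
  map_add' k k' := by
    have : pair (infinitesimalExtension K V (k + k')) Φ =
        pair (infinitesimalExtension K V k) Φ + pair (infinitesimalExtension K V k') Φ := by
      ext; simp [add_mul]
    rw [this, LinearMap.add_comp, neg_add]
  map_smul' c k := by
    have : pair (infinitesimalExtension K V (c • k)) Φ =
        c • pair (infinitesimalExtension K V k) Φ := by
      ext; simp [mul_assoc]
    rw [this, LinearMap.smul_comp, RingHom.id_apply, smul_neg]

theorem logStep_apply (Φ : Module.Dual K (TensorAlgebra K V)) (k : Module.Dual K V) (v : V) :
    logStep δplus Φ k v = -pair (infinitesimalExtension K V k) Φ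
      (δplus v - TensorAlgebra.ι K v ⊗ₜ 1) := rfl

theorem locallyNilpotent_logStep (h : GradedGenerators δplus δ gen deg)
    (Φ : Module.Dual K (TensorAlgebra K V)) :
    LocallyNilpotent (fun n => gen '' {g | deg g < n}) (logStep δplus Φ) where
  mono m n hmn := Set.image_mono fun g hg => lt_of_lt_of_le hg hmn
  zero := by simp
  span := by
    rw [← h.span_range, ← Set.image_iUnion, ← Set.image_univ]
    congr 2
    exact Set.eq_univ_of_forall fun g => Set.mem_iUnion.2 ⟨_, Nat.lt_succ_self _⟩
  step n k hk := by
    rintro _ ⟨g, hg, rfl⟩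
    rw [logStep_apply, neg_eq_zero]
    have h1 := h.plus_sub_mem g
    generalize δplus (gen g) - TensorAlgebra.ι K (gen g) ⊗ₜ 1 = t at h1 ⊢
    induction h1 using Submodule.span_induction with
    | mem t ht =>
      obtain ⟨p, l', hp, -, rfl⟩ := ht
      rw [pair_tmul, infinitesimalExtension_ι,
        hk _ ⟨p, hp.trans_le (Nat.lt_succ_iff.1 hg), rfl⟩, zero_mul]
    | zero => simp
    | add a b _ _ ha hb => simp [ha, hb]
    | smul c a _ ha => simp [ha]

/-- On a generator v, the leading term v ⊗ 1 contributes k(v) Φ(1) = k(v), which is solved for. On a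
word v | y both sides of the equation are those at v multiplied by Φ(y), because Φ is a character,
so nothing new is imposed. -/
theorem eq_add_precPlus_iff (h : GradedGenerators δplus δ gen deg)
    {Φ : Module.Dual K (TensorAlgebra K V)} (hΦ : Φ ∈ characters K V) (k : Module.Dual K V) :
    Φ = counit K V + precPlus δplus δ (infinitesimalExtension K V k) Φ ↔
      k = Φ ∘ₗ TensorAlgebra.ι K + logStep δplus Φ k := by
  have hκ := infinitesimalExtension_mem k
  have key : ∀ v, k v = (Φ ∘ₗ TensorAlgebra.ι K + logStep δplus Φ k) v ↔
      Φ (TensorAlgebra.ι K v) = pair (infinitesimalExtension K V k) Φ (δplus v) := fun v => by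
    rw [LinearMap.add_apply, logStep_apply, map_sub, pair_tmul, infinitesimalExtension_ι, hΦ.1,
      mul_one, neg_sub, LinearMap.comp_apply]
    constructor <;> intro hv <;> linear_combination -hv
  constructor
  · intro hsol
    refine LinearMap.ext fun v => (key v).2 ?_
    have h3 := DFunLike.congr_fun hsol (TensorAlgebra.ι K v * 1)
    rwa [LinearMap.add_apply, counit_mul, counit_ι, zero_mul, zero_add, h.precPlus_ι_mul hκ,
      mul_one, ← Algebra.TensorProduct.one_def, mul_one] at h3
  · intro hk
    refine linearMap_ext_ι_mul ?_ fun v y => ?_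
    · rw [LinearMap.add_apply, precPlus_apply_one, counit_one, add_zero, hΦ.1]
    · have hcomp : Φ ∘ₗ LinearMap.mulRight K y = Φ y • Φ :=
        LinearMap.ext fun x => by simp [characters.map_mul hΦ, mul_comm]
      rw [LinearMap.add_apply, counit_mul, counit_ι, zero_mul, zero_add, h.precPlus_ι_mul hκ,
        pair_mul_one_tmul, hcomp, pair_smul_right, LinearMap.smul_apply,
        ← (key v).1 (DFunLike.congr_fun hk v), characters.map_mul hΦ, smul_eq_mul, mul_comm]

theorem existsUnique_eq_add (h : GradedGenerators δplus δ gen deg)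
    {Φ : Module.Dual K (TensorAlgebra K V)} (hΦ : Φ ∈ characters K V) :
    ∃! κ, κ ∈ infinitesimalCharacters K V ∧ Φ = counit K V + precPlus δplus δ κ Φ := by
  obtain ⟨k, hk⟩ := (h.locallyNilpotent_logStep Φ).exists_eq_add (Φ ∘ₗ TensorAlgebra.ι K)
  refine ⟨infinitesimalExtension K V k,
    ⟨infinitesimalExtension_mem k, (h.eq_add_precPlus_iff hΦ k).2 hk⟩, ?_⟩
  rintro κ' ⟨hκ', hsol⟩
  -- An infinitesimal character is determined by its restriction to generators, so uniqueness of `k`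
  -- gives uniqueness of `κ`.
  have h1 : infinitesimalExtension K V (κ' ∘ₗ TensorAlgebra.ι K) = κ' :=
    infinitesimalCharacters.ext (infinitesimalExtension_mem _) hκ' fun v => by
      rw [infinitesimalExtension_ι]; rfl
  rw [← h1] at hsol ⊢
  rw [(h.locallyNilpotent_logStep Φ).unique ((h.eq_add_precPlus_iff hΦ _).1 hsol) hk]

end GradedGenerators

end Generic

/-! ## Connected components of the complement of a subset -/

theorem nonempty_of_mem_components {n : ℕ} {S J : Finset (Fin n)} (hJ : J ∈ components S) :
    J.Nonempty := by
  simp only [components, List.mem_map, Finset.mem_sort, Finset.mem_filter, Finset.mem_univ,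
    true_and] at hJ
  obtain ⟨i, hi, rfl⟩ := hJ
  refine ⟨i, ?_⟩
  simp only [Finset.mem_filter, Finset.mem_univ, true_and]
  exact ⟨le_rfl, fun k h1 h2 => le_antisymm h1 h2 ▸ hi.1⟩

theorem disjoint_of_mem_components {n : ℕ} {S J : Finset (Fin n)} (hJ : J ∈ components S) :
    Disjoint S J :=
  Finset.disjoint_right.2 fun j hj => (exists_mem_components_iff S j).1 ⟨J, hJ, hj⟩

theorem components_univ {n : ℕ} : components (Finset.univ : Finset (Fin n)) = [] := by
  refine List.eq_nil_iff_forall_not_mem.2 fun J hJ => ?_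
  obtain ⟨j, hj⟩ := nonempty_of_mem_components hJ
  exact (exists_mem_components_iff _ j).1 ⟨J, hJ, hj⟩ (Finset.mem_univ j)

theorem components_ne_nil {n : ℕ} {S : Finset (Fin n)} (hS : S ≠ Finset.univ) :
    components S ≠ [] := by
  obtain ⟨j, hj⟩ := not_forall.1 (mt Finset.eq_univ_iff_forall.2 hS)
  obtain ⟨J, hJ, -⟩ := (exists_mem_components_iff S j).2 hj
  exact List.ne_nil_of_mem hJ

theorem components_empty {n : ℕ} (hn : 0 < n) :
    components (∅ : Finset (Fin n)) = [Finset.univ] := by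
  have h : (Finset.univ.filter fun i : Fin n =>
      i ∉ (∅ : Finset (Fin n)) ∧ ∀ j < i, ∃ k ∈ (∅ : Finset (Fin n)), j ≤ k ∧ k < i) =
      {⟨0, hn⟩} := by
    ext i
    simp only [Finset.notMem_empty, not_false_eq_true, false_and, exists_false, imp_false,
      true_and, Finset.mem_filter, Finset.mem_univ, Finset.mem_singleton, not_lt]
    exact ⟨fun hi => le_antisymm (hi _) (Fin.mk_le_of_le_val (Nat.zero_le _)),
      fun hi j => hi ▸ Fin.mk_le_of_le_val (Nat.zero_le _)⟩
  rw [components, h, Finset.sort_singleton]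
  rw [List.map_singleton, Finset.filter_true_of_mem fun j _ =>
    ⟨Fin.mk_le_of_le_val (Nat.zero_le _), fun _ _ _ => Finset.notMem_empty _⟩]

/-- `T` accumulates the sets already counted, which keeps the induction going. -/
theorem sum_map_card_le {n : ℕ} {T : Finset (Fin n)} {l : List (Finset (Fin n))}
    (hl : l.Pairwise Disjoint) (hT : ∀ J ∈ l, Disjoint T J) :
    (l.map Finset.card).sum + T.card ≤ n := by
  induction l generalizing T with
  | nil => simpa using T.card_le_univ
  | cons J l ih =>
    rw [List.pairwise_cons] at hl
    have h := ih (T := T ∪ J) hl.2 fun J' hJ' =>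
      Finset.disjoint_union_left.2 ⟨hT J' (by simp [hJ']), hl.1 J' hJ'⟩
    rw [Finset.card_union_of_disjoint (hT J (by simp))] at h
    simp only [List.map_cons, List.sum_cons]
    omega

theorem sum_map_card_components_le {n : ℕ} (S : Finset (Fin n)) :
    ((components S).map Finset.card).sum + S.card ≤ n :=
  sum_map_card_le (pairwise_disjoint_components S) fun _ => disjoint_of_mem_components

/-! ## Generators with restrictions to subsets -/

section Restriction

variable {K : Type*} [Field K] {V : Type*} [AddCommMonoid V] [Module K V]
  {X : ℕ → Type*} (pull : ∀ {m n : ℕ}, (Fin m ↪o Fin n) → X n → X m) (gen : ∀ n : ℕ+, X n → V)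

/-- The restriction of `x` to `S`, as a generator of the tensor algebra; it is `1` for `S = ∅`. -/
def generatorAt (K : Type*) [Field K] {V : Type*} [AddCommMonoid V] [Module K V]
    {X : ℕ → Type*} (pull : ∀ {m n : ℕ}, (Fin m ↪o Fin n) → X n → X m)
    (gen : ∀ n : ℕ+, X n → V) {n : ℕ} (x : X n) (S : Finset (Fin n)) : TensorAlgebra K V :=
  if h : S.Nonempty then
    TensorAlgebra.ι K (gen ⟨S.card, h.card_pos⟩ (pull (S.orderEmbOfFin rfl) x))
  else 1

/-- The cardinality of `Finset.univ` equals `n` only propositionally, so the size `m` and the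
embedding are generalized first; after substitution, the only order embedding of `Fin n` in itself
is the identity. -/
theorem generatorAt_univ (hpull : ∀ n (x : X n), pull (RelEmbedding.refl _) x = x) (n : ℕ+)
    (x : X n) : generatorAt K pull gen x Finset.univ = TensorAlgebra.ι K (gen n x) := by
  have key : ∀ (m : ℕ) (hm : 0 < m) (e : Fin m ↪o Fin n), m = n →
      gen ⟨m, hm⟩ (pull e x) = gen n x := by
    rintro m hm e rfl
    have he : e = RelEmbedding.refl _ := DFunLike.coe_injective <|
      (e.strictMono.range_inj strictMono_id).1 <| by
        rw [(Finite.surjective_of_injective e.injective).range_eq, Set.range_id]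
    rw [he]
    exact congrArg (gen n) (hpull n x)
  have hne : (Finset.univ : Finset (Fin n)).Nonempty := ⟨⟨0, n.pos⟩, Finset.mem_univ _⟩
  rw [generatorAt, dif_pos hne]
  exact congrArg _ (key _ _ _ (by simp))

theorem counit_generatorAt {n : ℕ} (x : X n) {S : Finset (Fin n)} (hS : S.Nonempty) :
    counit K V (generatorAt K pull gen x S) = 0 := by
  rw [generatorAt, dif_pos hS, counit_ι]

theorem counit_prod_generatorAt {n : ℕ} (x : X n) {S : Finset (Fin n)} (hS : S ≠ Finset.univ) :
    counit K V ((components S).map (generatorAt K pull gen x)).prod = 0 := by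
  obtain ⟨J, l, hJ⟩ := List.exists_cons_of_ne_nil (components_ne_nil hS)
  rw [hJ, List.map_cons, List.prod_cons, counit_mul, counit_generatorAt _ _ _
    (nonempty_of_mem_components (S := S) (by simp [hJ])), zero_mul]

theorem exists_list_generatorAt {n : ℕ} (x : X n) (l : List (Finset (Fin n)))
    (hl : ∀ J ∈ l, J.Nonempty) : ∃ l' : List (Σ n : ℕ+, X n),
      l.map (generatorAt K pull gen x) = l'.map (fun g => TensorAlgebra.ι K (gen g.1 g.2)) ∧
      (l'.map fun g => (g.1 : ℕ)).sum = (l.map Finset.card).sum := by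
  induction l with
  | nil => exact ⟨[], by simp⟩
  | cons J l ih =>
    obtain ⟨l', h1, h2⟩ := ih fun J' hJ' => hl J' (by simp [hJ'])
    have hJ := hl J (by simp)
    refine ⟨⟨⟨J.card, hJ.card_pos⟩, pull (J.orderEmbOfFin rfl) x⟩ :: l', ?_, ?_⟩
    · rw [List.map_cons, List.map_cons, h1, generatorAt, dif_pos hJ]
    · simp [h2]

/-- The right factor of the term of S has nonzero augmentation only for S = [n], the left one only
for S = ∅, which gives the counit laws. If S contains 1 and S ≠ [n], then 0 < |S| < n and the
components have total size at most n - |S| < n. -/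
theorem gradedGenerators_of_restriction (hpull : ∀ n (x : X n), pull (RelEmbedding.refl _) x = x)
    (hspan : Submodule.span K (Set.range fun g : Σ n : ℕ+, X n => gen g.1 g.2) = ⊤)
    (P : ∀ n : ℕ+, X n → Finset (Finset (Fin n)))
    (huniv : ∀ n x, Finset.univ ∈ P n x) (hempty : ∀ n x, ∅ ∈ P n x)
    {δplus δ : V →ₗ[K] TensorAlgebra K V ⊗[K] TensorAlgebra K V}
    (hδ : ∀ n x, δ (gen n x) = ∑ S ∈ P n x, generatorAt K pull gen x S ⊗ₜ
      ((components S).map (generatorAt K pull gen x)).prod)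
    (hplus : ∀ n x, δplus (gen n x) = ∑ S ∈ (P n x).filter (fun S => (⟨0, n.pos⟩ : Fin n) ∈ S),
      generatorAt K pull gen x S ⊗ₜ ((components S).map (generatorAt K pull gen x)).prod) :
    GradedGenerators δplus δ (fun g : Σ n : ℕ+, X n => gen g.1 g.2) (fun g => (g.1 : ℕ)) where
  deg_pos g := g.1.pos
  span_range := hspan
  contractRight_plus := by
    rintro ⟨n, x⟩
    rw [hplus, map_sum, Finset.sum_eq_single Finset.univ]
    · simp [components_univ, counit_one, generatorAt_univ pull gen hpull]
    · intro S _ hS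
      rw [contractRight_tmul, counit_prod_generatorAt _ _ _ hS, zero_smul]
    · exact fun h => absurd (Finset.mem_filter.2 ⟨huniv n x, Finset.mem_univ (⟨0, n.pos⟩ : Fin n)⟩) h
  contractRight_coproduct := by
    rintro ⟨n, x⟩
    rw [hδ, map_sum, Finset.sum_eq_single Finset.univ]
    · simp [components_univ, counit_one, generatorAt_univ pull gen hpull]
    · intro S _ hS
      rw [contractRight_tmul, counit_prod_generatorAt _ _ _ hS, zero_smul]
    · simp [huniv]
  contractLeft_coproduct := by
    rintro ⟨n, x⟩
    rw [hδ, map_sum, Finset.sum_eq_single ∅]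
    · rw [components_empty n.pos, contractLeft_tmul, List.map_singleton, List.prod_singleton,
        generatorAt_univ pull gen hpull, generatorAt, dif_neg Finset.not_nonempty_empty,
        counit_one, one_smul]
    · intro S _ hS
      rw [contractLeft_tmul, counit_generatorAt _ _ _ (Finset.nonempty_iff_ne_empty.2 hS),
        zero_smul]
    · simp [hempty]
  plus_sub_mem := by
    rintro ⟨n, x⟩
    rw [hplus, ← Finset.add_sum_erase _ _
      (Finset.mem_filter.2 ⟨huniv n x, Finset.mem_univ (⟨0, n.pos⟩ : Fin n)⟩),
      generatorAt_univ pull gen hpull, components_univ, List.map_nil, List.prod_nil,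
      add_sub_cancel_left]
    refine Submodule.sum_mem _ fun S hS => Submodule.subset_span ?_
    obtain ⟨hne, hS⟩ := Finset.mem_erase.1 hS
    have hS0 : S.Nonempty := ⟨_, (Finset.mem_filter.1 hS).2⟩
    obtain ⟨l', h1, h2⟩ := exists_list_generatorAt (K := K) pull gen x (components S)
      fun _ => nonempty_of_mem_components
    have h3 := sum_map_card_components_le S
    have h4 := hS0.card_pos
    refine ⟨⟨⟨S.card, hS0.card_pos⟩, pull (S.orderEmbOfFin rfl) x⟩, l', ?_, ?_, ?_⟩
    · simpa using Finset.card_lt_univ_of_notMem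
        (not_forall.1 (mt Finset.eq_univ_iff_forall.2 hne)).choose_spec
    · dsimp only at h2 ⊢
      omega
    · rw [h1, generatorAt, dif_pos hS0]

end Restriction

/-! ## The two tensor algebras -/

section Instances

variable (K : Type*) [Field K] (A : Type*) [AddCommMonoid A] [Module K A]

theorem wordsCoproduct_lof_tprod (n : ℕ+) (a : Fin n → A) :
    wordsCoproduct K A (DirectSum.lof K ℕ+ (fun n : ℕ+ => ⨂[K]^(n : ℕ) A) n
      (PiTensorProduct.tprod K a)) =
      ∑ S, wordAt K A S a ⊗ₜ[K] ((components S).map fun J => wordAt K A J a).prod := by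
  simp [wordsCoproduct, coproductTerm_apply]

theorem wordsLeftPlus_lof_tprod (n : ℕ+) (a : Fin n → A) :
    wordsLeftPlus K A (DirectSum.lof K ℕ+ (fun n : ℕ+ => ⨂[K]^(n : ℕ) A) n
      (PiTensorProduct.tprod K a)) =
      ∑ S ∈ Finset.univ.filter (fun S : Finset (Fin n) => (⟨0, n.pos⟩ : Fin n) ∈ S),
        wordAt K A S a ⊗ₜ[K] ((components S).map fun J => wordAt K A J a).prod := by
  simp [wordsLeftPlus, coproductTerm_apply]

theorem span_range_lof_tprod :
    Submodule.span K (Set.range fun g : Σ n : ℕ+, (Fin n → A) =>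
      DirectSum.lof K ℕ+ (fun n : ℕ+ => ⨂[K]^(n : ℕ) A) g.1 (PiTensorProduct.tprod K g.2)) =
      ⊤ := by
  refine top_le_iff.1 fun x _ => ?_
  set M := Submodule.span K (Set.range fun g : Σ n : ℕ+, (Fin n → A) =>
      DirectSum.lof K ℕ+ (fun n : ℕ+ => ⨂[K]^(n : ℕ) A) g.1 (PiTensorProduct.tprod K g.2))
  have h : ∀ n : ℕ+, ∀ w, DirectSum.lof K ℕ+ (fun n : ℕ+ => ⨂[K]^(n : ℕ) A) n w ∈ M :=
    fun n w => by
      have hle : Submodule.span K (Set.range (PiTensorProduct.tprod K)) ≤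
          M.comap (DirectSum.lof K ℕ+ (fun n : ℕ+ => ⨂[K]^(n : ℕ) A) n) := by
        refine Submodule.span_le.2 ?_
        rintro _ ⟨a, rfl⟩
        exact Submodule.subset_span ⟨⟨n, a⟩, rfl⟩
      rw [PiTensorProduct.span_tprod_eq_top] at hle
      exact hle Submodule.mem_top
  induction x using DirectSum.induction_on with
  | zero => exact M.zero_mem
  | of n w => exact h n w
  | add x y hx hy => exact M.add_mem (hx trivial) (hy trivial)

theorem gradedGenerators_words :
    GradedGenerators (wordsLeftPlus K A) (wordsCoproduct K A)
      (fun g : Σ n : ℕ+, (Fin n → A) =>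
        DirectSum.lof K ℕ+ (fun n : ℕ+ => ⨂[K]^(n : ℕ) A) g.1 (PiTensorProduct.tprod K g.2))
      (fun g => (g.1 : ℕ)) :=
  gradedGenerators_of_restriction (X := fun n => Fin n → A) (fun e a => a ∘ e)
    (fun n a => DirectSum.lof K ℕ+ (fun n : ℕ+ => ⨂[K]^(n : ℕ) A) n (PiTensorProduct.tprod K a))
    (fun _ _ => rfl) (span_range_lof_tprod K A) (fun _ _ => Finset.univ)
    (fun _ _ => Finset.mem_univ _) (fun _ _ => Finset.mem_univ _)
    (wordsCoproduct_lof_tprod K A) (wordsLeftPlus_lof_tprod K A)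

namespace NCPartition

/-- The partition induced by a non-crossing partition along an order embedding. -/
def pull {m n : ℕ} (e : Fin m ↪o Fin n) (L : NCPartition n) : NCPartition m where
  rel := L.rel.comap e
  noncrossing _ _ _ _ h₁ h₂ h₃ := L.noncrossing _ _ _ _
    (e.lt_iff_lt.2 h₁) (e.lt_iff_lt.2 h₂) (e.lt_iff_lt.2 h₃)

theorem admissible_univ {n : ℕ} (L : NCPartition n) : L.Admissible Finset.univ :=
  ⟨fun _ _ _ _ => Finset.mem_univ _, fun _ _ t ht => absurd (Finset.mem_univ t) ht⟩

theorem admissible_empty {n : ℕ} (L : NCPartition n) : L.Admissible ∅ :=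
  ⟨fun _ _ _ h => absurd h (Finset.notMem_empty _), fun _ h => absurd h (Finset.notMem_empty _)⟩

end NCPartition

theorem span_range_decorate :
    Submodule.span K (Set.range fun g : Σ n : ℕ+, NCPartition n × (Fin n → A) =>
      decorate K A g.1 g.2.1 (PiTensorProduct.tprod K g.2.2)) = ⊤ := by
  refine top_le_iff.1 fun x _ => ?_
  set M := Submodule.span K (Set.range fun g : Σ n : ℕ+, NCPartition n × (Fin n → A) =>
      decorate K A g.1 g.2.1 (PiTensorProduct.tprod K g.2.2))
  have h : ∀ (n : ℕ+) L w, decorate K A n L w ∈ M := fun n L w => by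
    have hle : Submodule.span K (Set.range (PiTensorProduct.tprod K)) ≤
        M.comap (decorate K A n L) := by
      refine Submodule.span_le.2 ?_
      rintro _ ⟨a, rfl⟩
      exact Submodule.subset_span ⟨⟨n, L, a⟩, rfl⟩
    rw [PiTensorProduct.span_tprod_eq_top] at hle
    exact hle Submodule.mem_top
  induction x using DirectSum.induction_on with
  | zero => exact M.zero_mem
  | of n t =>
    change DirectSum.lof K ℕ+ (fun n : ℕ+ => (NCPartition n →₀ K) ⊗[K] ⨂[K]^(n : ℕ) A) n t ∈ M
    induction t with
    | zero => simp
    | add s t hs ht => rw [map_add]; exact M.add_mem (hs trivial) (ht trivial)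
    | tmul f w =>
      induction f using Finsupp.induction_linear with
      | zero => simp
      | add f g hf hg =>
        rw [TensorProduct.add_tmul, map_add]
        exact M.add_mem (hf trivial) (hg trivial)
      | single L c =>
        have hs : Finsupp.single L c = c • Finsupp.single L (1 : K) := by simp
        rw [hs, ← TensorProduct.smul_tmul', map_smul]
        exact M.smul_mem c (h n L w)
  | add x y hx hy => exact M.add_mem (hx trivial) (hy trivial)

open Classical in
theorem gradedGenerators_nc :
    GradedGenerators (ncLeftPlus K A) (ncCoproduct K A)
      (fun g : Σ n : ℕ+, NCPartition n × (Fin n → A) =>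
        decorate K A g.1 g.2.1 (PiTensorProduct.tprod K g.2.2))
      (fun g => (g.1 : ℕ)) :=
  gradedGenerators_of_restriction (X := fun n => NCPartition n × (Fin n → A))
    (fun e x => (x.1.pull e, x.2 ∘ e))
    (fun n x => decorate K A n x.1 (PiTensorProduct.tprod K x.2))
    (fun _ _ => rfl) (span_range_decorate K A)
    (fun _ x => Finset.univ.filter fun S => x.1.Admissible S)
    (fun _ x => by simpa using x.1.admissible_univ)
    (fun _ x => by simpa using x.1.admissible_empty)
    -- Pulling back along the enumeration of S unfolds to `restrict`, so `generatorAt` and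
    -- `decoratedAt` agree definitionally.
    (fun n x => ncSum_decorate K A _ n x.1 x.2)
    (fun n x => by rw [Finset.filter_filter]; exact ncSum_decorate K A _ n x.1 x.2)

end Instances

/-! ## Gluing non-crossing partitions along a splitting -/

theorem mem_of_mem_components_of_le {n : ℕ} {S J : Finset (Fin n)} (hJ : J ∈ components S)
    {i j k : Fin n} (hi : i ∈ J) (hk : k ∈ J) (hij : i ≤ j) (hjk : j ≤ k) : j ∈ J := by
  simp only [components, List.mem_map] at hJ
  obtain ⟨i₀, -, rfl⟩ := hJ
  simp only [Finset.mem_filter, Finset.mem_univ, true_and] at hi hk ⊢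
  exact ⟨hi.1.trans hij, fun l h1 h2 => hk.2 l h1 (h2.trans hjk)⟩

/-- Maximality of components: between any earlier point and the least element of a component there
is an element of S. -/
theorem mem_component_of_forall_notMem {n : ℕ} {S J : Finset (Fin n)} (hJ : J ∈ components S)
    {i j : Fin n} (hij : i ≤ j) (hS : ∀ k, i ≤ k → k ≤ j → k ∉ S) : i ∈ J ↔ j ∈ J := by
  simp only [components, List.mem_map, Finset.mem_sort, Finset.mem_filter, Finset.mem_univ,
    true_and] at hJ
  obtain ⟨i₀, hi₀, rfl⟩ := hJ
  simp only [Finset.mem_filter, Finset.mem_univ, true_and]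
  constructor
  · rintro ⟨h1, h2⟩
    refine ⟨h1.trans hij, fun k hk hkj => ?_⟩
    rcases le_total k i with h | h
    · exact h2 k hk h
    · exact hS k h hkj
  · rintro ⟨h1, h2⟩
    refine ⟨?_, fun k hk hki => h2 k hk (hki.trans hij)⟩
    by_contra hlt
    obtain ⟨k, hk, hik, hki⟩ := hi₀.2 i (not_le.1 hlt)
    exact hS k hik (hki.le.trans h1) hk

namespace NCPartition

variable {n : ℕ}

theorem ext_rel {L L' : NCPartition n} (h : ∀ i j, L.rel i j ↔ L'.rel i j) : L = L' :=
  rel_injective n (funext fun i => funext fun j => propext (h i j))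

theorem restrict_rel_iff (L : NCPartition n) (S : Finset (Fin n)) (p q : Fin S.card) :
    (L.restrict S).rel p q ↔ L.rel (S.orderEmbOfFin rfl p) (S.orderEmbOfFin rfl q) := Iff.rfl

theorem exists_orderEmbOfFin_eq {S : Finset (Fin n)} {i : Fin n} (hi : i ∈ S) :
    ∃ p, S.orderEmbOfFin rfl p = i := by
  have : i ∈ Set.range (S.orderEmbOfFin rfl) := by simpa using hi
  exact this

theorem rel_iff_of_restrict_eq {L L' : NCPartition n} {S : Finset (Fin n)}
    (h : L.restrict S = L'.restrict S) {i j : Fin n} (hi : i ∈ S) (hj : j ∈ S) :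
    L.rel i j ↔ L'.rel i j := by
  obtain ⟨p, rfl⟩ := exists_orderEmbOfFin_eq hi
  obtain ⟨q, rfl⟩ := exists_orderEmbOfFin_eq hj
  rw [← restrict_rel_iff, ← restrict_rel_iff, h]

/-- If k were in S, its block would differ from that of i and j. Non-crossing forces every m in it
to satisfy i < m < j: otherwise m < i < k < j or i < k < j < m is a crossing. So it would be nested
in a block outside S. -/
theorem Admissible.notMem_of_lt_of_lt {L : NCPartition n} {S : Finset (Fin n)}
    (hL : L.Admissible S) {i j k : Fin n} (hij : L.rel i j) (hi : i ∉ S) (hik : i < k)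
    (hkj : k < j) : k ∉ S := by
  intro hk
  have hik' : ¬ L.rel k i := fun h => hi (hL.1 k i h hk)
  have hjk' : ¬ L.rel j k := fun h => hik' (L.rel.symm' (L.rel.trans' hij h))
  refine hL.2 k hk i hi fun m hm => ⟨⟨i, L.rel.refl' i, ?_⟩, ⟨j, hij, ?_⟩⟩
  · rcases lt_trichotomy i m with h | rfl | h
    · exact h
    · exact absurd hm hik'
    · exact absurd ⟨L.rel.symm' hm, hik', hij⟩ (L.noncrossing m i k j h hik hkj)
  · rcases lt_trichotomy m j with h | rfl | h
    · exact h
    · exact absurd (L.rel.symm' hm) hjk'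
    · exact absurd ⟨hij, hjk', hm⟩ (L.noncrossing i k j m hik hkj h)

/-- A block outside S cannot jump over a point of S, so it stays in one component. -/
theorem Admissible.mem_component_of_rel {L : NCPartition n} {S J : Finset (Fin n)}
    (hL : L.Admissible S) (hJ : J ∈ components S) {i j : Fin n} (hij : L.rel i j) (hi : i ∈ J) :
    j ∈ J := by
  have hiS : i ∉ S := Finset.disjoint_right.1 (disjoint_of_mem_components hJ) hi
  have hjS : j ∉ S := fun h => hiS (hL.1 j i (L.rel.symm' hij) h)
  have key : ∀ {i j}, L.rel i j → i ∉ S → j ∉ S → ∀ k, i ≤ k → k ≤ j → k ∉ S := by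
    intro i j hij hi hj k hik hkj
    rcases hik.eq_or_lt with rfl | hik
    · exact hi
    rcases hkj.eq_or_lt with rfl | hkj
    · exact hj
    exact hL.notMem_of_lt_of_lt hij hi hik hkj
  rcases le_total i j with h | h
  · exact (mem_component_of_forall_notMem hJ h (key hij hiS hjS)).1 hi
  · exact (mem_component_of_forall_notMem hJ h (key (L.rel.symm' hij) hjS hiS)).2 hi

section Glue

variable {ι : Type*} (parts : ι → Finset (Fin n)) (M : ∀ o, NCPartition (parts o).card)

/-- The relation on `[n]` glued from non-crossing partitions of the parts of `[n]`. -/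
def GlueRel (i j : Fin n) : Prop :=
  ∃ o p q, (parts o).orderEmbOfFin rfl p = i ∧ (parts o).orderEmbOfFin rfl q = j ∧ (M o).rel p q

variable {parts}

/-- Disjointness makes the part containing a given point unique. -/
theorem glueRel_iff (hdisj : ∀ o o' i, i ∈ parts o → i ∈ parts o' → o = o') (o : ι)
    (p : Fin (parts o).card) (j : Fin n) : GlueRel parts M ((parts o).orderEmbOfFin rfl p) j ↔
      ∃ q, (parts o).orderEmbOfFin rfl q = j ∧ (M o).rel p q := by
  constructor
  · rintro ⟨o', p', q', hp, rfl, hpq⟩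
    obtain rfl := hdisj o' o _ ((parts o').orderEmbOfFin_mem rfl p')
      (hp ▸ (parts o).orderEmbOfFin_mem rfl p)
    obtain rfl := ((parts o').orderEmbOfFin rfl).injective hp
    exact ⟨q', rfl, hpq⟩
  · rintro ⟨q, rfl, hpq⟩
    exact ⟨o, p, q, rfl, rfl, hpq⟩

/-- The non-crossing partition of `[n]` glued from non-crossing partitions of parts of `[n]` that
do not cross each other. -/
def glue (hcover : ∀ i, ∃ o, i ∈ parts o)
    (hdisj : ∀ o o' i, i ∈ parts o → i ∈ parts o' → o = o')
    (hcross : ∀ o o' p₁ q₁ p₂ q₂, p₁ < q₁ → q₁ < p₂ → p₂ < q₂ → p₁ ∈ parts o → p₂ ∈ parts o →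
      q₁ ∈ parts o' → q₂ ∈ parts o' → o = o') : NCPartition n where
  rel :=
    { r := GlueRel parts M
      iseqv :=
        { refl := fun i => by
            obtain ⟨o, ho⟩ := hcover i
            obtain ⟨p, rfl⟩ := exists_orderEmbOfFin_eq ho
            exact ⟨o, p, p, rfl, rfl, (M o).rel.refl' p⟩
          symm := by
            rintro i j ⟨o, p, q, rfl, rfl, h⟩
            exact ⟨o, q, p, rfl, rfl, (M o).rel.symm' h⟩
          trans := by
            rintro i j k ⟨o, p, q, rfl, rfl, h⟩ hjk
            obtain ⟨t, rfl, ht⟩ := (glueRel_iff M hdisj o q k).1 hjk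
            exact ⟨o, p, t, rfl, rfl, (M o).rel.trans' h ht⟩ } }
  noncrossing := by
    rintro p₁ q₁ p₂ q₂ h₁ h₂ h₃ ⟨⟨o, a, b, rfl, rfl, hab⟩, hn, ⟨o', c, d, rfl, rfl, hcd⟩⟩
    obtain rfl := hcross o o' _ _ _ _ h₁ h₂ h₃ ((parts o).orderEmbOfFin_mem rfl a)
      ((parts o).orderEmbOfFin_mem rfl b) ((parts o').orderEmbOfFin_mem rfl c)
      ((parts o').orderEmbOfFin_mem rfl d)
    rw [OrderEmbedding.lt_iff_lt] at h₁ h₂ h₃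
    exact (M o).noncrossing a c b d h₁ h₂ h₃
      ⟨hab, fun h => hn ⟨o, b, c, rfl, rfl, h⟩, hcd⟩

theorem glue_rel_iff (hcover : ∀ i, ∃ o, i ∈ parts o)
    (hdisj : ∀ o o' i, i ∈ parts o → i ∈ parts o' → o = o') (hcross) (i j : Fin n) :
    (glue M hcover hdisj hcross).rel i j ↔ GlueRel parts M i j := Iff.rfl

theorem mem_of_glueRel (hdisj : ∀ o o' i, i ∈ parts o → i ∈ parts o' → o = o') {o : ι}
    {i j : Fin n} (h : GlueRel parts M i j) (hi : i ∈ parts o) : j ∈ parts o := by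
  obtain ⟨p, rfl⟩ := exists_orderEmbOfFin_eq hi
  obtain ⟨q, rfl, -⟩ := (glueRel_iff M hdisj o p j).1 h
  exact (parts o).orderEmbOfFin_mem rfl q

theorem restrict_glue (hcover : ∀ i, ∃ o, i ∈ parts o)
    (hdisj : ∀ o o' i, i ∈ parts o → i ∈ parts o' → o = o') (hcross) (o : ι) :
    (glue M hcover hdisj hcross).restrict (parts o) = M o := by
  refine ext_rel fun p q => ?_
  rw [restrict_rel_iff, glue_rel_iff, glueRel_iff M hdisj]
  constructor
  · rintro ⟨q', hq, h⟩
    rwa [← ((parts o).orderEmbOfFin rfl).injective hq]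
  · exact fun h => ⟨q, rfl, h⟩

end Glue

/-- Every choice of non-crossing partitions of `S` and of the components of its complement comes
from a non-crossing partition for which `S` is admissible. -/
theorem exists_admissible_restrict_eq (S : Finset (Fin n)) (M : NCPartition S.card)
    (r : ∀ t : Fin (components S).length, NCPartition ((components S).get t).card) :
    ∃ L : NCPartition n, L.Admissible S ∧ L.restrict S = M ∧
      ∀ t, L.restrict ((components S).get t) = r t := by
  -- The index `none` stands for S, `some t` for the t-th component.
  let parts : Option (Fin (components S).length) → Finset (Fin n) :=
    fun o => o.elim S (components S).get
  let M' : ∀ o, NCPartition (parts o).card := fun o => match o with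
    | none => M
    | some t => r t
  have hmem : ∀ t, (components S).get t ∈ components S := List.get_mem _
  have hcover : ∀ i, ∃ o, i ∈ parts o := fun i => by
    by_cases hi : i ∈ S
    · exact ⟨none, hi⟩
    · obtain ⟨J, hJ, hiJ⟩ := (exists_mem_components_iff S i).2 hi
      obtain ⟨t, rfl⟩ := List.get_of_mem hJ
      exact ⟨some t, hiJ⟩
  have hdisj : ∀ o o' i, i ∈ parts o → i ∈ parts o' → o = o' := by
    rintro (_ | t) (_ | t') i hi hi'
    · rfl
    · exact absurd hi (Finset.disjoint_right.1 (disjoint_of_mem_components (hmem t')) hi')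
    · exact absurd hi' (Finset.disjoint_right.1 (disjoint_of_mem_components (hmem t)) hi)
    · have hp := List.pairwise_iff_get.1 (pairwise_disjoint_components S)
      rcases lt_trichotomy t t' with h | rfl | h
      · exact absurd hi' (Finset.disjoint_left.1 (hp t t' h) hi)
      · rfl
      · exact absurd hi (Finset.disjoint_left.1 (hp t' t h) hi')
  -- Of two different parts at least one is a component, hence an interval; if the parts alternated,
  -- that interval would contain a point of the other part.
  have hcross : ∀ o o' p₁ q₁ p₂ q₂, p₁ < q₁ → q₁ < p₂ → p₂ < q₂ → p₁ ∈ parts o → p₂ ∈ parts o →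
      q₁ ∈ parts o' → q₂ ∈ parts o' → o = o' := by
    rintro (_ | t) o' p₁ q₁ p₂ q₂ h₁ h₂ h₃ hp₁ hp₂ hq₁ hq₂
    · rcases o' with _ | t'
      · rfl
      · exact hdisj _ _ p₂ hp₂ (mem_of_mem_components_of_le (hmem t') hq₁ hq₂ h₂.le h₃.le)
    · exact hdisj _ _ q₁ (mem_of_mem_components_of_le (hmem t) hp₁ hp₂ h₁.le h₂.le) hq₁
  refine ⟨glue M' hcover hdisj hcross, ⟨fun i j hij hi => ?_, fun q hq t ht hn => ?_⟩,
    restrict_glue M' hcover hdisj hcross none, fun t => restrict_glue M' hcover hdisj hcross (some t)⟩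
  · exact mem_of_glueRel M' hdisj (o := none) hij hi
  · obtain ⟨_ | s, hs⟩ := hcover t
    · exact ht hs
    -- Nesting is tested at q itself: it would lie between two points u, v of one component, hence
    -- in that component, although q is in S.
    · obtain ⟨⟨u, hu, huq⟩, ⟨v, hv, hqv⟩⟩ := hn q (Setoid.refl' _ q)
      have hu' : u ∈ (components S).get s := mem_of_glueRel M' hdisj (o := some s) hu hs
      have hv' : v ∈ (components S).get s := mem_of_glueRel M' hdisj (o := some s) hv hs
      exact Finset.disjoint_left.1 (disjoint_of_mem_components (hmem s)) hq
        (mem_of_mem_components_of_le (hmem s) hu' hv' huq.le hqv.le)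

/-- Related points lie both in S or both in one component, so the restrictions see every relation.
-/
theorem Admissible.eq_of_restrict_eq {S : Finset (Fin n)} {L L' : NCPartition n}
    (hL : L.Admissible S) (hL' : L'.Admissible S) (hS : L.restrict S = L'.restrict S)
    (hJ : ∀ J ∈ components S, L.restrict J = L'.restrict J) : L = L' := by
  have key : ∀ {L L' : NCPartition n}, L.Admissible S → L.restrict S = L'.restrict S →
      (∀ J ∈ components S, L.restrict J = L'.restrict J) → ∀ i j, L.rel i j → L'.rel i j := by
    intro L L' hL hS hJ i j hij
    by_cases hi : i ∈ S
    · exact (rel_iff_of_restrict_eq hS hi (hL.1 i j hij hi)).1 hij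
    · obtain ⟨J, hJS, hiJ⟩ := (exists_mem_components_iff S i).2 hi
      exact (rel_iff_of_restrict_eq (hJ J hJS) hiJ (hL.mem_component_of_rel hJS hij hiJ)).1 hij
  exact ext_rel fun i j => ⟨key hL hS hJ i j, key hL' hS.symm (fun J h => (hJ J h).symm) i j⟩

end NCPartition

/-- Distributivity for ordered products in an algebra that need not be commutative, from
multilinearity of the product. -/
theorem list_prod_map_sum {R : Type*} [CommSemiring R] {B : Type*} [Semiring B] [Algebra R B]
    {ι : Type*} {Y : ι → Type*} [∀ j, Fintype (Y j)] (w : ∀ j, Y j → B) (l : List ι) :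
    (l.map fun j => ∑ y, w j y).prod =
      ∑ r : ∀ t : Fin l.length, Y (l.get t), (List.ofFn fun t => w (l.get t) (r t)).prod := by
  classical
  have h := (MultilinearMap.mkPiAlgebraFin R l.length B).map_sum
    (g := fun t (y : Y (l.get t)) => w (l.get t) y)
  simp only [MultilinearMap.mkPiAlgebraFin_apply] at h
  rw [← h]
  congr 1
  exact (List.ofFn_getElem_eq_map l fun j => ∑ y, w j y).symm

/-! ### Compatibility of the splitting map with the coproducts. -/

section Compatibility

variable {K : Type*} [Field K]

open Classical in
/-- The splitting formula: a product of sums over the non-crossing partitions of `S` and of the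
components of its complement is a sum over the partitions for which `S` is admissible. -/
theorem sum_tmul_prod_sum {B : Type*} [Semiring B] [Algebra K B] {n : ℕ} (S : Finset (Fin n))
    (w : ∀ J : Finset (Fin n), NCPartition J.card → B) :
    (∑ M, w S M) ⊗ₜ[K] ((components S).map fun J => ∑ M, w J M).prod =
      ∑ L ∈ Finset.univ.filter fun L : NCPartition n => L.Admissible S,
        w S (L.restrict S) ⊗ₜ[K] ((components S).map fun J => w J (L.restrict J)).prod := by
  rw [list_prod_map_sum (R := K), TensorProduct.sum_tmul]
  simp only [TensorProduct.tmul_sum]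
  rw [← Fintype.sum_prod_type']
  symm
  refine Finset.sum_bij
    (fun L _ => (L.restrict S, fun t => L.restrict ((components S).get t)))
    (fun _ _ => Finset.mem_univ _) ?_ ?_ ?_
  · intro L hL L' hL' h
    rw [Prod.mk.injEq] at h
    refine (Finset.mem_filter.1 hL).2.eq_of_restrict_eq (Finset.mem_filter.1 hL').2 h.1
      fun J hJ => ?_
    obtain ⟨t, rfl⟩ := List.get_of_mem hJ
    exact congrFun h.2 t
  · rintro ⟨M, r⟩ -
    obtain ⟨L, hL, h1, h2⟩ := NCPartition.exists_admissible_restrict_eq S M r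
    exact ⟨L, by simpa using hL, Prod.ext h1 (funext h2)⟩
  · intro L _
    congr 2
    exact (List.ofFn_getElem_eq_map (components S) fun J => w J (L.restrict J)).symm

variable (K) (A : Type*) [AddCommMonoid A] [Module K A]

/-- The generator `M ⊗ a_J` for a non-crossing partition `M` of `J`; it is `1` for `J = ∅`. -/
def decoratedOn {n : ℕ} (a : Fin n → A) (J : Finset (Fin n)) (M : NCPartition J.card) :
    TensorAlgebra K (DecoratedNC K A) :=
  if h : J.Nonempty then
    TensorAlgebra.ι K (decorate K A ⟨J.card, h.card_pos⟩ M (subword K J a))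
  else 1

theorem decoratedOn_restrict {n : ℕ} (a : Fin n → A) (J : Finset (Fin n)) (L : NCPartition n) :
    decoratedOn K A a J (L.restrict J) = decoratedAt K A L J a := rfl

theorem splitWords_lof (n : ℕ+) (w : ⨂[K]^(n : ℕ) A) :
    splitWords K A (DirectSum.lof K ℕ+ (fun n : ℕ+ => ⨂[K]^(n : ℕ) A) n w) =
      ∑ L, decorate K A n L w := by
  simp [splitWords]

theorem split_ι (v : Words K A) :
    split K A (TensorAlgebra.ι K v) = TensorAlgebra.ι K (splitWords K A v) := by
  simp [split]

theorem split_wordAt {n : ℕ} (a : Fin n → A) (J : Finset (Fin n)) :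
    split K A (wordAt K A J a) = ∑ M, decoratedOn K A a J M := by
  by_cases h : J.Nonempty
  · simp only [wordAt, decoratedOn, dif_pos h, split_ι]
    exact (congrArg _ (splitWords_lof K A ⟨J.card, h.card_pos⟩ _)).trans (map_sum _ _ _)
  -- For empty `J` the sum has a single term 1, as the empty set has exactly one partition.
  · simp only [wordAt, decoratedOn, dif_neg h, map_one]
    obtain rfl := Finset.not_nonempty_iff_eq_empty.1 h
    have hsub : ∀ M M' : NCPartition (∅ : Finset (Fin n)).card, M = M' := fun M M' =>
      NCPartition.ext_rel fun i => absurd i.2 (by simp)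
    have hne : Nonempty (NCPartition (∅ : Finset (Fin n)).card) :=
      ⟨⟨⊤, fun i => absurd i.2 (by simp)⟩⟩
    have : Fintype.card (NCPartition (∅ : Finset (Fin n)).card) = 1 :=
      Fintype.card_eq_one_iff.2 ⟨hne.some, fun M => hsub M _⟩
    rw [Finset.sum_const, Finset.card_univ, this, one_smul]

theorem map_split_term {n : ℕ} (a : Fin n → A) (S : Finset (Fin n)) :
    Algebra.TensorProduct.map (split K A) (split K A)
      (wordAt K A S a ⊗ₜ[K] ((components S).map fun J => wordAt K A J a).prod) =
    (∑ M, decoratedOn K A a S M) ⊗ₜ[K]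
      ((components S).map fun J => ∑ M, decoratedOn K A a J M).prod := by
  rw [Algebra.TensorProduct.map_tmul, map_list_prod, List.map_map, split_wordAt]
  congr 3
  funext J
  exact split_wordAt K A a J

/-- By `sum_tmul_prod_sum`, one side sums over S and then over the L for which S is admissible, the
other over the same pairs in the opposite order. -/
theorem map_split_wordsCoproduct (v : Words K A) :
    Algebra.TensorProduct.map (split K A) (split K A) (wordsCoproduct K A v) =
      ncCoproduct K A (splitWords K A v) := by
  classical
  refine DFunLike.congr_fun ((gradedGenerators_words K A).linearMap_ext
    (f := (Algebra.TensorProduct.map (split K A) (split K A)).toLinearMap ∘ₗ wordsCoproduct K A)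
    (f' := ncCoproduct K A ∘ₗ splitWords K A) ?_) v
  rintro ⟨n, a⟩
  simp only [LinearMap.comp_apply, AlgHom.toLinearMap_apply, wordsCoproduct_lof_tprod, map_sum,
    map_split_term, sum_tmul_prod_sum, splitWords_lof, ncCoproduct, ncSum_decorate,
    decoratedOn_restrict]
  refine Finset.sum_comm' fun S L => ?_
  simp

/-- The condition 1 ∈ S does not involve L, so it survives the exchange of sums. -/
theorem map_split_wordsLeftPlus (v : Words K A) :
    Algebra.TensorProduct.map (split K A) (split K A) (wordsLeftPlus K A v) =
      ncLeftPlus K A (splitWords K A v) := by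
  classical
  refine DFunLike.congr_fun ((gradedGenerators_words K A).linearMap_ext
    (f := (Algebra.TensorProduct.map (split K A) (split K A)).toLinearMap ∘ₗ wordsLeftPlus K A)
    (f' := ncLeftPlus K A ∘ₗ splitWords K A) ?_) v
  rintro ⟨n, a⟩
  simp only [LinearMap.comp_apply, AlgHom.toLinearMap_apply, wordsLeftPlus_lof_tprod, map_sum,
    map_split_term, sum_tmul_prod_sum, splitWords_lof, ncLeftPlus, ncSum_decorate,
    decoratedOn_restrict]
  refine Finset.sum_comm' fun S L => ?_
  simp only [Finset.mem_filter, Finset.mem_univ, true_and, and_true]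
  exact and_comm

theorem map_split_coproduct (x : TensorAlgebra K (Words K A)) :
    Algebra.TensorProduct.map (split K A) (split K A) (coproduct (wordsCoproduct K A) x) =
      coproduct (ncCoproduct K A) (split K A x) := by
  have : (Algebra.TensorProduct.map (split K A) (split K A)).comp
      (coproduct (wordsCoproduct K A)) = (coproduct (ncCoproduct K A)).comp (split K A) := by
    apply TensorAlgebra.hom_ext
    refine LinearMap.ext fun v => ?_
    simp only [LinearMap.comp_apply, AlgHom.toLinearMap_apply, AlgHom.comp_apply, coproduct,
      TensorAlgebra.lift_ι_apply, split_ι, map_split_wordsCoproduct]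
  exact DFunLike.congr_fun this x

theorem map_split_leftHalfPlus (x : TensorAlgebra K (Words K A)) :
    Algebra.TensorProduct.map (split K A) (split K A)
      (leftHalfPlus (wordsLeftPlus K A) (wordsCoproduct K A) x) =
      leftHalfPlus (ncLeftPlus K A) (ncCoproduct K A) (split K A x) := by
  refine DFunLike.congr_fun (linearMap_ext_ι_mul
    (f := (Algebra.TensorProduct.map (split K A) (split K A)).toLinearMap ∘ₗ
      leftHalfPlus (wordsLeftPlus K A) (wordsCoproduct K A))
    (g := leftHalfPlus (ncLeftPlus K A) (ncCoproduct K A) ∘ₗ (split K A).toLinearMap) ?_ ?_) x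
  · simp [leftHalfPlus_one]
  · intro v y
    simp only [LinearMap.comp_apply, AlgHom.toLinearMap_apply, leftHalfPlus_ι_mul, map_mul,
      split_ι, map_split_wordsLeftPlus, map_split_coproduct]

theorem splitDual_apply (f : Module.Dual K (TensorAlgebra K (DecoratedNC K A)))
    (x : TensorAlgebra K (Words K A)) : splitDual K A f x = f (split K A x) := rfl

theorem splitDual_counit : splitDual K A (counit K (DecoratedNC K A)) = counit K (Words K A) :=
  linearMap_ext_ι_mul (by simp [splitDual_apply, counit_one]) fun v y => by
    simp [splitDual_apply, counit_mul, split_ι, counit_ι]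

theorem counit_split (x : TensorAlgebra K (Words K A)) :
    counit K (DecoratedNC K A) (split K A x) = counit K (Words K A) x :=
  DFunLike.congr_fun (splitDual_counit K A) x

theorem splitDual_mem_characters {Φ : Module.Dual K (TensorAlgebra K (DecoratedNC K A))}
    (hΦ : Φ ∈ characters K (DecoratedNC K A)) : splitDual K A Φ ∈ characters K (Words K A) :=
  ⟨by simp [splitDual_apply, hΦ.1], fun a b _ _ => by
    simp only [splitDual_apply, map_mul, characters.map_mul hΦ]⟩

theorem splitDual_mem_infinitesimalCharacters
    {κ : Module.Dual K (TensorAlgebra K (DecoratedNC K A))}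
    (hκ : κ ∈ infinitesimalCharacters K (DecoratedNC K A)) :
    splitDual K A κ ∈ infinitesimalCharacters K (Words K A) :=
  ⟨by simp [splitDual_apply, hκ.1], fun a b ha hb => by
    rw [splitDual_apply, map_mul]
    exact hκ.2 _ _ (by rw [counit_split, ha]) (by rw [counit_split, hb])⟩

theorem splitDual_precPlus (κ g : Module.Dual K (TensorAlgebra K (DecoratedNC K A))) :
    splitDual K A (precPlus (ncLeftPlus K A) (ncCoproduct K A) κ g) =
      precPlus (wordsLeftPlus K A) (wordsCoproduct K A) (splitDual K A κ) (splitDual K A g) := by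
  refine LinearMap.ext fun x => ?_
  rw [splitDual_apply, precPlus_apply, precPlus_apply, ← map_split_leftHalfPlus]
  generalize leftHalfPlus (wordsLeftPlus K A) (wordsCoproduct K A) x = t
  induction t with
  | zero => simp
  | tmul a b => simp [splitDual_apply]
  | add a b ha hb => simp only [map_add, ha, hb]

end Compatibility

end SplittingProcess

end

/-! ### The correspondence and its image under the dual splitting map. -/

open SplittingProcess
theorem mainTheorem4 {K : Type*} [Field K] [CharZero K] {A : Type*} [NonUnitalRing A]
    [Module K A] [IsScalarTower K A A] [SMulCommClass K A A] :
    (∀ κ ∈ infinitesimalCharacters K (DecoratedNC K A), PrecExpConverges (ncLeftHalf K A) κ) ∧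
    Set.BijOn (precExp (ncLeftHalf K A)) (infinitesimalCharacters K (DecoratedNC K A))
      (characters K (DecoratedNC K A)) ∧
    (∀ Φ ∈ characters K (DecoratedNC K A), ∃ κ ∈ infinitesimalCharacters K (DecoratedNC K A),
      Φ = counit K (DecoratedNC K A) + prec (ncLeftHalf K A) κ Φ ∧
      Φ = precExp (ncLeftHalf K A) κ ∧
      ∀ κ' ∈ infinitesimalCharacters K (DecoratedNC K A),
        (Φ = counit K (DecoratedNC K A) + prec (ncLeftHalf K A) κ' Φ ∨
          Φ = precExp (ncLeftHalf K A) κ') → κ' = κ) ∧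
    (∀ κ ∈ infinitesimalCharacters K (DecoratedNC K A),
      precExp (ncLeftHalf K A) κ ∈ characters K (DecoratedNC K A)) ∧
    (∀ Φ ∈ characters K (DecoratedNC K A), ∀ κ ∈ infinitesimalCharacters K (DecoratedNC K A),
      Φ = counit K (DecoratedNC K A) + prec (ncLeftHalf K A) κ Φ →
      splitDual K A Φ ∈ characters K (Words K A) ∧
      splitDual K A κ ∈ infinitesimalCharacters K (Words K A) ∧
      splitDual K A Φ = counit K (Words K A) +
        prec (wordsLeftHalf K A) (splitDual K A κ) (splitDual K A Φ) ∧
      PrecExpConverges (wordsLeftHalf K A) (splitDual K A κ) ∧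
      splitDual K A Φ = precExp (wordsLeftHalf K A) (splitDual K A κ)) := by
  have h := gradedGenerators_nc K A
  have hw := gradedGenerators_words K A
  have hsol : ∀ κ ∈ infinitesimalCharacters K (DecoratedNC K A), ∀ Φ,
      Φ = counit K (DecoratedNC K A) + prec (ncLeftHalf K A) κ Φ ↔
        Φ = precExp (ncLeftHalf K A) κ := fun κ hκ Φ => by
    rw [ncLeftHalf, h.eq_precExp_iff hκ, h.prec_eq_precPlus hκ.1]
  have hinj : ∀ Φ ∈ characters K (DecoratedNC K A),
      ∃! κ, κ ∈ infinitesimalCharacters K (DecoratedNC K A) ∧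
        Φ = precExp (ncLeftHalf K A) κ := fun Φ hΦ => by
    refine (existsUnique_congr fun κ => and_congr_right fun hκ => ?_).1 (h.existsUnique_eq_add hΦ)
    exact (h.eq_precExp_iff hκ).symm
  have hmaps : ∀ κ ∈ infinitesimalCharacters K (DecoratedNC K A),
      precExp (ncLeftHalf K A) κ ∈ characters K (DecoratedNC K A) := fun κ hκ =>
    h.precExp_mem_characters hκ
  refine ⟨fun κ hκ => h.precExpConverges hκ, ⟨hmaps, fun κ hκ κ' hκ' he => ?_, fun Φ hΦ => ?_⟩,
    fun Φ hΦ => ?_, hmaps, fun Φ hΦ κ hκ hΦκ => ?_⟩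
  · exact (hinj _ (hmaps κ hκ)).unique ⟨hκ, rfl⟩ ⟨hκ', he⟩
  · obtain ⟨κ, ⟨hκ, he⟩, -⟩ := hinj Φ hΦ
    exact ⟨κ, hκ, he.symm⟩
  · obtain ⟨κ, ⟨hκ, he⟩, huniq⟩ := hinj Φ hΦ
    refine ⟨κ, hκ, (hsol κ hκ Φ).2 he, he, fun κ' hκ' hor => huniq κ' ⟨hκ', ?_⟩⟩
    exact hor.elim (hsol κ' hκ' Φ).1 id
  · have hκ' := splitDual_mem_infinitesimalCharacters K A hκ
    -- Only the fixed-point equation is transported; the exponential over words then comes from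
    -- uniqueness of its solution, without comparing the series term by term.
    have heq : splitDual K A Φ = counit K (Words K A) +
        precPlus (wordsLeftPlus K A) (wordsCoproduct K A) (splitDual K A κ)
          (splitDual K A Φ) := by
      rw [ncLeftHalf, h.prec_eq_precPlus hκ.1] at hΦκ
      conv_lhs => rw [hΦκ]
      rw [map_add, splitDual_counit, splitDual_precPlus]
    refine ⟨splitDual_mem_characters K A hΦ, hκ', ?_, hw.precExpConverges hκ',
      (hw.eq_precExp_iff hκ').2 heq⟩
    rw [wordsLeftHalf, hw.prec_eq_precPlus hκ'.1]
    exact heq
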